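/- A digraph has no loops and no repeated arcs, but may contain both arcs $uv$ and $vu$; its base graph is obtained by forgetting orientations, and $\delta^+$ denotes its minimum out-degree. For an integer $r\ge 3$ and a digraph $R$, let $\mathcal K_{r,r-2}(R)$ be the set of all (not necessarily induced) subdigraphs $K$ of $R$ on $r$ vertices with complete base graph and $\delta^+(K)\ge r-2$. A perfect fractional $(r,r-2)$-tiling of $R$ is a function $\omega:\mathcal K_{r,r-2}(R)\to[0,1]$ such that $\sum_{K\in\mathcal K_{r,r-2}(R),\,v\in V(K)}\omega(K)=1$ for every vertex $v$ of $R$. For an edge-coloured graph $G$ (with an arbitrary, not necessarily proper, edge-colouring), the minimum colour degree $\delta^c(G)$ is the minimum over all vertices $v$ of the number of distinct colours on edges incident to $v$; a subgraph is rainbow if its edges have pairwise distinct colours; and a rainbow-$K_r$-tiling is a collection of vertex-disjoint rainbow copies of $K_r$ in $G$ (colours may repeat between different copies). \textbf{Lemma.} For every integer $r\ge 3$ and every $\gamma>0$ there is $\varepsilon_0>0$ such that for every $0<\varepsilon\le\varepsilon_0$ there is $t_0$ such that for every integer $t\ge t_0$ there is $n_0$ such that the following holds for every integer $n\ge n_0$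 and every real $\delta$. Suppose that every digraph $R$ on $t$ vertices with $\delta^+(R)\ge\delta t$ contains a perfect fractional $(r,r-2)$-tiling. Then every edge-coloured graph $G$ on $n$ vertices with $\delta^c(G)\ge(\delta+3\gamma)n$ contains a rainbow-$K_r$-tiling covering all but at most $3\varepsilon^{1/2}n$ vertices of $G$. -/

import Mathlib

section AlmostTiling

/-- A digraph has no loops (antiparallel pairs of arcs are allowed). -/
def DigraphLoopless {V : Type*} (D : Digraph V) : Prop :=
  ∀ v, ¬ D.Adj v v

/-- The out-degree of a vertex in a (finite) digraph. -/
noncomputable def outDeg {V : Type*} (D : Digraph V) (v : V) : ℕ :=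
  {w | D.Adj v w}.ncard

/-- The minimum out-degree of a digraph. -/
noncomputable def minOutDeg {V : Type*} (D : Digraph V) : ℕ :=
  ⨅ v, outDeg D v

/-- `K = (S, A)`, with vertex set `S` and arc set `A`, is a copy in `D` of a member of the family of
digraphs on `r` vertices with minimum out-degree at least `r - 2` and complete base graph.
Copies are subdigraphs of `D`, not necessarily induced. -/
structure IsTileCopy {V : Type*} (r : ℕ) (D : Digraph V) (K : Finset V × Finset (V × V)) :
    Prop where
  card_verts : K.1.card = r
  arcs_mem : ∀ a ∈ K.2, a.1 ∈ K.1 ∧ a.2 ∈ K.1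
  arcs_adj : ∀ a ∈ K.2, D.Adj a.1 a.2
  base_complete : ∀ u ∈ K.1, ∀ v ∈ K.1, u ≠ v → (u, v) ∈ K.2 ∨ (v, u) ∈ K.2
  le_outDeg : ∀ u ∈ K.1, r - 2 ≤ {w | (u, w) ∈ K.2}.ncard

open Classical in
/-- The set of all copies in `D` of digraphs on `r` vertices with minimum out-degree at least
`r - 2` and complete base graph. -/
noncomputable def tileCopies {V : Type*} [Fintype V] (r : ℕ) (D : Digraph V) :
    Finset (Finset V × Finset (V × V)) :=
  Finset.univ.filter (IsTileCopy r D)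

open Classical in
/-- The total weight of the copies that contain the vertex `v`. -/
noncomputable def tileWeightAt {V : Type*} [Fintype V] (r : ℕ) (D : Digraph V)
    (ω : Finset V × Finset (V × V) → ℝ) (v : V) : ℝ :=
  ∑ K ∈ (tileCopies r D).filter (fun K => v ∈ K.1), ω K

/-- `ω` is a fractional `(r, r-2)`-tiling of `D`; only its values on `tileCopies r D` matter. -/
def IsFractionalTiling {V : Type*} [Fintype V] (r : ℕ) (D : Digraph V)
    (ω : Finset V × Finset (V × V) → ℝ) : Prop :=
  (∀ K ∈ tileCopies r D, ω K ∈ Set.Icc (0 : ℝ) 1) ∧ ∀ v, tileWeightAt r D ω v ≤ 1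

/-- `D` contains a perfect fractional `(r, r-2)`-tiling. -/
def HasPerfectFractionalTiling {V : Type*} [Fintype V] (r : ℕ) (D : Digraph V) : Prop :=
  ∃ ω, IsFractionalTiling r D ω ∧ ∀ v, tileWeightAt r D ω v = 1

/-- The colour degree of `v`: the number of distinct colours on edges incident to `v`. -/
noncomputable def colourDeg {V C : Type*} {G : SimpleGraph V} (c : G.EdgeLabeling C) (v : V) : ℕ :=
  {κ | ∃ e : G.edgeSet, v ∈ (e : Sym2 V) ∧ c e = κ}.ncard

/-- The minimum colour degree of an edge-coloured graph. -/
noncomputable def minColourDeg {V C : Type*} {G : SimpleGraph V} (c : G.EdgeLabeling C) : ℕ :=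
  ⨅ v, colourDeg c v

/-- `S` is the vertex set of a rainbow `K_r`: an `r`-clique whose edges have distinct colours. -/
def IsRainbowClique {V C : Type*} {G : SimpleGraph V} (c : G.EdgeLabeling C) (r : ℕ)
    (S : Finset V) : Prop :=
  G.IsNClique r S ∧
    ∀ e f : G.edgeSet, (∀ v ∈ (e : Sym2 V), v ∈ S) → (∀ v ∈ (f : Sym2 V), v ∈ S) →
      c e = c f → e = f

/-- `T` is (the family of vertex sets of) a rainbow-`K_r`-tiling: a collection of vertex-disjoint
rainbow copies of `K_r`. -/
def IsRainbowCliqueTiling {V C : Type*} {G : SimpleGraph V} (c : G.EdgeLabeling C) (r : ℕ)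
    (T : Finset (Finset V)) : Prop :=
  (∀ S ∈ T, IsRainbowClique c r S) ∧ ∀ S ∈ T, ∀ S' ∈ T, S ≠ S' → Disjoint S S'

/-- The number of vertices that lie in no member of `T`. -/
noncomputable def numUncovered {V : Type*} (T : Finset (Finset V)) : ℕ :=
  {v | ∀ S ∈ T, v ∉ S}.ncard

end AlmostTiling

/-! A rainbow tiling `T` with the most members is shown to cover almost everything: if it left too
much uncovered, a bounded number of its members could be exchanged for more cliques. No regularity
lemma is used; sampling and a hypergraph Turán argument provide the blow-up.

Keep one edge per colour at each vertex, oriented outwards; this gives a digraph `D` whose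
out-degrees dominate the colour degrees. Cut almost all vertices into blocks of size `r`, namely the
members of `T` and groups of uncovered vertices. A random sequence of `t / r + 1` blocks induces a
digraph on `t` vertices. By the second moment, the expected number of vertices of out-degree below
`δ * t` is bounded independently of `t`, while the expected number of uncovered blocks grows
linearly in `t`. So a positive proportion of samples have at least two more uncovered blocks than
low vertices (`card_filter_good_samples`). By pigeonhole, densely many of them share one digraph `R`
and one set of uncovered positions, and `exists_box_subset` then yields a blow-up of `R` inside `D`.

Adding all arcs out of the set `F` of low vertices makes the hypothesis applicable to `R`.
Discarding the copies that meet `F` and rounding the weights leaves a multiset of tiles of `R`,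
realised greedily by disjoint rainbow cliques in the blow-up. This works because two edges of a tile
can share a colour for at most one choice of a suitable vertex (`exists_arc_head_avoiding`). Each
low vertex costs at most one block's worth of cliques and each uncovered block saves one, so the
exchange enlarges `T`. -/

/-! ### Complete boxes in dense sets of sequences -/

/-- Erdős's theorem on complete `q`-partite hypergraphs, by induction on `q`. Fix a bounded set `Z`
of first coordinates of large degree. Many tails extend by at least `b` elements of `Z`; by
pigeonhole over the subsets of `Z`, densely many tails have the same extensions, and induction
applies to these tails. -/
theorem exists_box_subset (q : ℕ) : ∀ (b : ℕ) (α : ℝ), 0 < α → ∃ N₀ : ℕ,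
    ∀ (β : Type*) [Fintype β], N₀ ≤ Fintype.card β → ∀ E : Finset (Fin q → β),
      α * (Fintype.card β : ℝ) ^ q ≤ E.card →
      ∃ A : Fin q → Finset β, (∀ j, (A j).card = b) ∧ ∀ x, (∀ j, x j ∈ A j) → x ∈ E := by
  classical
  induction q with
  | zero =>
    intro b α hα
    refine ⟨0, fun β _ _ E hE => ⟨fun j => j.elim0, fun j => j.elim0, fun x _ => ?_⟩⟩
    have h : 0 < (E.card : ℝ) := lt_of_lt_of_le (by simpa using hα) hE
    obtain ⟨y, hy⟩ := Finset.card_pos.1 (by exact_mod_cast h)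
    rwa [Subsingleton.elim x y]
  | succ q ih =>
    intro b α hα
    obtain ⟨L, hL⟩ : ∃ L : ℕ, 4 * b / α + 1 ≤ (L : ℝ) := exists_nat_ge _
    have hL0 : 0 < (L : ℝ) := lt_of_lt_of_le (by positivity) hL
    have hbL : (b : ℝ) ≤ α / 4 * L := by
      have : 4 * b / α ≤ (L : ℝ) := by linarith
      rw [div_le_iff₀ hα] at this
      linarith
    obtain ⟨N₁, hN₁⟩ := ih b (α / 4 / 2 ^ L) (by positivity)
    obtain ⟨N₂, hN₂⟩ : ∃ N₂ : ℕ, 2 * L / α + 1 ≤ (N₂ : ℝ) := exists_nat_ge _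
    refine ⟨max N₁ N₂, fun β _ hN E hE => ?_⟩
    have hNN₂ : (N₂ : ℝ) ≤ Fintype.card β := by exact_mod_cast (le_max_right _ _).trans hN
    set N : ℝ := (Fintype.card β : ℝ) with hNdef
    have hN0 : 0 < N := lt_of_lt_of_le (lt_of_lt_of_le (by positivity) hN₂) hNN₂
    have hNL : (L : ℝ) ≤ α / 2 * N := by
      have : 2 * L / α ≤ N := by linarith
      rw [div_le_iff₀ hα] at this
      linarith
    have hNq : 0 < N ^ q := by positivity
    have hcard : ((Finset.univ : Finset (Fin q → β)).card : ℝ) = N ^ q := by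
      simp [hNdef]
    let deg : β → Finset (Fin q → β) := fun y => Finset.univ.filter fun x => Fin.cons y x ∈ E
    have hdeg : ∀ y, ((deg y).card : ℝ) ≤ N ^ q := fun y => by
      rw [← hcard]; exact_mod_cast Finset.card_le_card (Finset.subset_univ _)
    have hEsum : (E.card : ℝ) = ∑ y, ((deg y).card : ℝ) := by
      have h1 : E.card = ∑ y, (E.filter fun x => x 0 = y).card :=
        Finset.card_eq_sum_card_fiberwise fun _ _ => Finset.mem_univ _
      rw [h1]
      push_cast
      refine Finset.sum_congr rfl fun y _ => ?_
      congr 1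
      refine Finset.card_bij (fun x _ => Fin.tail x) ?_ ?_ ?_
      · intro x hx
        obtain ⟨hx1, rfl⟩ := Finset.mem_filter.1 hx
        simpa [deg] using hx1
      · intro x hx x' hx' h
        rw [← Fin.cons_self_tail x, ← Fin.cons_self_tail x', h, (Finset.mem_filter.1 hx).2,
          (Finset.mem_filter.1 hx').2]
      · intro x hx
        exact ⟨Fin.cons y x, by simpa [deg] using hx, by simp⟩
    let H : Finset β := Finset.univ.filter fun y => α / 2 * N ^ q ≤ ((deg y).card : ℝ)
    have hH : L ≤ H.card := by
      have h1 : (E.card : ℝ) ≤ H.card * N ^ q + N * (α / 2 * N ^ q) := by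
        rw [hEsum, ← Finset.sum_filter_add_sum_filter_not _
          (fun y => α / 2 * N ^ q ≤ ((deg y).card : ℝ))]
        refine add_le_add ?_ ?_
        · rw [← nsmul_eq_mul]
          exact Finset.sum_le_card_nsmul _ _ _ fun y _ => hdeg y
        · refine (Finset.sum_le_card_nsmul _ _ (α / 2 * N ^ q) fun y hy => ?_).trans ?_
          · exact (not_le.1 (Finset.mem_filter.1 hy).2).le
          · rw [nsmul_eq_mul]
            refine mul_le_mul_of_nonneg_right ?_ (by positivity)
            rw [hNdef]
            exact_mod_cast Finset.card_le_univ _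
      have h2 : α * N ^ (q + 1) ≤ H.card * N ^ q + N * (α / 2 * N ^ q) := hE.trans h1
      have h3 : (α / 2 * N) * N ^ q ≤ H.card * N ^ q := by
        rw [pow_succ] at h2; nlinarith
      have h4 := le_of_mul_le_mul_right h3 hNq
      exact_mod_cast hNL.trans h4
    obtain ⟨Z, hZH, hZ⟩ := Finset.exists_subset_card_eq hH
    let S : (Fin q → β) → Finset β := fun x => Z.filter fun y => Fin.cons y x ∈ E
    have hSsum : L * (α / 2 * N ^ q) ≤ ∑ x, ((S x).card : ℝ) := by
      have h1 : ∑ x, (S x).card = ∑ y ∈ Z, (deg y).card :=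
        Finset.sum_card_bipartiteAbove_eq_sum_card_bipartiteBelow
          (s := Finset.univ) (t := Z) (fun x y => (Fin.cons y x : Fin (q + 1) → β) ∈ E)
      have h2 : ∑ x, ((S x).card : ℝ) = ∑ y ∈ Z, ((deg y).card : ℝ) := by exact_mod_cast h1
      rw [h2, ← hZ, ← nsmul_eq_mul]
      exact Finset.card_nsmul_le_sum _ _ _ fun y hy => (Finset.mem_filter.1 (hZH hy)).2
    let X : Finset (Fin q → β) := Finset.univ.filter fun x => b ≤ (S x).card
    have hX : α / 4 * N ^ q ≤ X.card := by
      have h1 : ∑ x, ((S x).card : ℝ) ≤ X.card * L + N ^ q * b := by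
        rw [← Finset.sum_filter_add_sum_filter_not _ (fun x => b ≤ (S x).card)]
        refine add_le_add ?_ ?_
        · rw [← nsmul_eq_mul]
          refine Finset.sum_le_card_nsmul _ _ _ fun x _ => ?_
          rw [← hZ]
          exact_mod_cast Finset.card_filter_le _ _
        · refine (Finset.sum_le_card_nsmul _ _ (b : ℝ) fun x hx => ?_).trans ?_
          · exact_mod_cast (not_le.1 (Finset.mem_filter.1 hx).2).le
          · rw [nsmul_eq_mul, ← hcard]
            refine mul_le_mul_of_nonneg_right ?_ (by positivity)
            exact_mod_cast Finset.card_le_card (Finset.subset_univ _)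
      have h2 : (α / 4 * N ^ q) * L ≤ X.card * L := by nlinarith [hSsum.trans h1]
      exact le_of_mul_le_mul_right h2 hL0
    have hmaps : ∀ x ∈ X, S x ∈ Z.powerset := fun x _ =>
      Finset.mem_powerset.2 (Finset.filter_subset _ _)
    have hZne : Z.powerset.Nonempty := ⟨∅, by simp⟩
    -- Only `2 ^ L` sets can occur, a number independent of the size of `β`, so the density stays
    -- bounded below.
    obtain ⟨S₀, -, hS₀⟩ := Finset.exists_le_card_fiber_of_nsmul_le_card_of_maps_to
      (M := ℝ) (b := α / 4 / 2 ^ L * N ^ q) hmaps hZne (by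
        rw [Finset.card_powerset, hZ, nsmul_eq_mul]
        push_cast
        calc (2 : ℝ) ^ L * (α / 4 / 2 ^ L * N ^ q) = α / 4 * N ^ q := by field_simp
          _ ≤ _ := hX)
    have hpos : 0 < (((X.filter fun x => S x = S₀).card : ℕ) : ℝ) :=
      lt_of_lt_of_le (by positivity) hS₀
    obtain ⟨x₀, hx₀⟩ := Finset.card_pos.1 (by exact_mod_cast hpos)
    obtain ⟨hx₀X, hx₀S⟩ := Finset.mem_filter.1 hx₀
    have hbS₀ : b ≤ S₀.card := hx₀S ▸ (Finset.mem_filter.1 hx₀X).2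
    obtain ⟨A₀, hA₀S, hA₀⟩ := Finset.exists_subset_card_eq hbS₀
    obtain ⟨A, hA, hAE⟩ := hN₁ β ((le_max_left _ _).trans hN) _ hS₀
    refine ⟨Fin.cons A₀ A, fun j => ?_, fun x hx => ?_⟩
    · refine Fin.cases ?_ (fun j => ?_) j
      · simpa using hA₀
      · simpa using hA j
    · have h1 := hAE (Fin.tail x) fun j => by simpa [Fin.tail] using hx j.succ
      have h2 : x 0 ∈ S (Fin.tail x) := by
        rw [(Finset.mem_filter.1 h1).2]
        exact hA₀S (by simpa using hx 0)
      simpa using (Finset.mem_filter.1 h2).2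

/-! ### First and second moments of uniform samples, as sums over all sequences -/

section Sampling

variable {ι β : Type*} [Fintype ι] [DecidableEq ι] [Fintype β]

theorem sum_eq_zero_of_sum_update_eq_zero (F : (ι → β) → ℝ) (k : ι)
    (h : ∀ x, ∑ y, F (Function.update x k y) = 0) : ∑ x, F x = 0 := by
  rw [← (Equiv.funSplitAt k β).symm.sum_comp F, Fintype.sum_prod_type, Finset.sum_comm]
  refine Finset.sum_eq_zero fun z _ => ?_
  rcases isEmpty_or_nonempty β with hβ | ⟨⟨y₀⟩⟩
  · simp
  · rw [← h ((Equiv.funSplitAt k β).symm (y₀, z))]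
    refine Finset.sum_congr rfl fun y _ => congrArg F ?_
    ext j
    by_cases hj : j = k
    · subst hj; simp [Equiv.funSplitAt, Equiv.piSplitAt]
    · simp [Equiv.funSplitAt, Equiv.piSplitAt, hj]

/-- A variance bound: the cross terms vanish. Of two distinct indices one differs from `j₀`, and
averaging over that coordinate gives zero. This holds even when the other index is `j₀`, where the
summand itself need not have mean zero. -/
theorem sum_sq_sum_le (g : β → β → ℝ) (M : ℝ) (hg : ∀ z, ∑ y, g z y = 0)
    (hM : ∀ z y, |g z y| ≤ M) (j₀ : ι) :
    ∑ x : ι → β, (∑ j, g (x j₀) (x j)) ^ 2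
      ≤ Fintype.card ι * M ^ 2 * (Fintype.card β : ℝ) ^ Fintype.card ι := by
  have hvanish : ∀ k l, k ≠ l → k ≠ j₀ →
      ∑ x : ι → β, g (x j₀) (x k) * g (x j₀) (x l) = 0 := by
    intro k l hkl hk
    refine sum_eq_zero_of_sum_update_eq_zero _ k fun x => ?_
    simp only [Function.update_self, Function.update_of_ne hk.symm, Function.update_of_ne hkl.symm]
    rw [← Finset.sum_mul, hg, zero_mul]
  have hoff : ∀ k l, k ≠ l → ∑ x : ι → β, g (x j₀) (x k) * g (x j₀) (x l) = 0 := by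
    intro k l hkl
    by_cases hk : k = j₀
    · rw [← hvanish l k hkl.symm (hk ▸ hkl.symm)]
      exact Finset.sum_congr rfl fun x _ => mul_comm _ _
    · exact hvanish k l hkl hk
  calc ∑ x : ι → β, (∑ j, g (x j₀) (x j)) ^ 2
      = ∑ k, ∑ l, ∑ x : ι → β, g (x j₀) (x k) * g (x j₀) (x l) := by
        simp only [sq, Finset.sum_mul_sum]
        rw [Finset.sum_comm]
        exact Finset.sum_congr rfl fun k _ => Finset.sum_comm
    _ = ∑ k, ∑ x : ι → β, g (x j₀) (x k) * g (x j₀) (x k) := by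
        refine Finset.sum_congr rfl fun k _ => ?_
        exact Finset.sum_eq_single k (fun l _ hl => hoff k l hl.symm) (by simp)
    _ ≤ ∑ _k : ι, ∑ _x : ι → β, M ^ 2 := by
        refine Finset.sum_le_sum fun k _ => Finset.sum_le_sum fun x _ => ?_
        rw [← sq]
        exact sq_le_sq' (abs_le.1 (hM _ _)).1 (abs_le.1 (hM _ _)).2
    _ = _ := by simp; ring

theorem sum_card_filter_mem (U : Finset β) [DecidableEq β] :
    ∑ x : ι → β, ((Finset.univ.filter fun j => x j ∈ U).card : ℝ) * Fintype.card β
      = Fintype.card ι * U.card * (Fintype.card β : ℝ) ^ Fintype.card ι := by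
  have h : ∀ j : ι, ∑ x : ι → β, ((if x j ∈ U then (1 : ℝ) else 0) * Fintype.card β - U.card) = 0 := by
    intro j
    refine sum_eq_zero_of_sum_update_eq_zero _ j fun x => ?_
    simp [Finset.sum_sub_distrib, mul_comm]
  have h' : ∀ j : ι, ∑ x : ι → β, ((if x j ∈ U then (1 : ℝ) else 0) * Fintype.card β)
      = U.card * (Fintype.card β : ℝ) ^ Fintype.card ι := by
    intro j
    have := h j
    rw [Finset.sum_sub_distrib, sub_eq_zero] at this
    rw [this]; simp [mul_comm]
  simp only [Finset.card_filter]
  push_cast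
  simp only [Finset.sum_mul]
  rw [Finset.sum_comm, Finset.sum_congr rfl fun j _ => h' j]
  simp [mul_assoc]

end Sampling

/-! ### Digraphs with one out-arc per colour -/

open Classical in
/-- The colour of an unordered pair, `none` for a non-edge. -/
noncomputable def pairColour {V C : Type*} {G : SimpleGraph V} (c : G.EdgeLabeling C)
    (e : Sym2 V) : Option C :=
  if h : e ∈ G.edgeSet then some (c ⟨e, h⟩) else none

/-- The digraph `D` consists of edges of `G`, and at every vertex the out-going arcs have distinct
colours. -/
structure IsOutRainbow {V C : Type*} {G : SimpleGraph V} (c : G.EdgeLabeling C)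
    (D : Digraph V) : Prop where
  adj : ∀ {v w}, D.Adj v w → G.Adj v w
  eq_of_colour : ∀ {v w w'}, D.Adj v w → D.Adj v w' →
    pairColour c s(v, w) = pairColour c s(v, w') → w = w'

theorem pairColour_eq_some {V C : Type*} {G : SimpleGraph V} (c : G.EdgeLabeling C)
    (e : G.edgeSet) : pairColour c e = some (c e) := by
  simp [pairColour]

theorem exists_isOutRainbow {V C : Type*} [Finite V] {G : SimpleGraph V} (c : G.EdgeLabeling C) :
    ∃ D : Digraph V, IsOutRainbow c D ∧ ∀ v, colourDeg c v ≤ outDeg D v := by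
  choose N hN hbij using fun v : V =>
    Set.exists_subset_bijOn {w | G.Adj v w} (fun w => pairColour c s(v, w))
  refine ⟨⟨fun v w => w ∈ N v⟩, ⟨fun h => hN _ h, fun h h' he => (hbij _).injOn h h' he⟩,
    fun v => ?_⟩
  change _ ≤ (N v).ncard
  rw [← (hbij v).injOn.ncard_image, (hbij v).image_eq, colourDeg,
    ← Set.ncard_image_of_injective _ (Option.some_injective C)]
  refine Set.ncard_le_ncard ?_ (Set.toFinite _)
  rintro _ ⟨κ, ⟨e, hv, rfl⟩, rfl⟩
  obtain ⟨w, hw⟩ := Sym2.mem_iff_exists.1 hv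
  refine ⟨w, ?_, ?_⟩
  · have := e.2
    rwa [hw] at this
  · change pairColour c s(v, w) = _
    rw [← hw, pairColour_eq_some]

/-! ### Pairs of edges in a tile -/

namespace IsTileCopy

variable {W : Type*} {r : ℕ} {R : Digraph W} {K : Finset W × Finset (W × W)}

/-- Out-degree at least `r - 2` lets `y` miss at most one of the other `r - 1` vertices. -/
theorem arc_or_arc_of_in_in (hK : IsTileCopy r R K) (hR : DigraphLoopless R) {x y z : W}
    (hx : x ∈ K.1) (hy : y ∈ K.1) (hz : z ∈ K.1) (hxy : x ≠ y) (hzy : z ≠ y) (hxz : x ≠ z) :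
    (y, x) ∈ K.2 ∨ (y, z) ∈ K.2 := by
  classical
  by_contra! h
  have hsub : {w | (y, w) ∈ K.2} ⊆ (((K.1.erase x).erase y).erase z : Finset W) := by
    intro w hw
    have hw' : (y, w) ∈ K.2 := hw
    simp only [Finset.coe_erase, Set.mem_sdiff, Finset.mem_coe, Set.mem_singleton_iff]
    refine ⟨⟨⟨(hK.arcs_mem _ hw').2, ?_⟩, ?_⟩, ?_⟩
    · rintro rfl; exact h.1 hw'
    · rintro rfl; exact hR _ (hK.arcs_adj _ hw')
    · rintro rfl; exact h.2 hw'
  have h1 := Set.ncard_le_ncard hsub (Finset.finite_toSet _)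
  rw [Set.ncard_coe_finset, Finset.card_erase_of_mem, Finset.card_erase_of_mem,
    Finset.card_erase_of_mem hx, hK.card_verts] at h1
  · have h2 := hK.le_outDeg y hy
    have h3 : ({x, y, z} : Finset W).card ≤ K.1.card :=
      Finset.card_le_card (by intro w; simp; rintro (rfl | rfl | rfl) <;> assumption)
    rw [hK.card_verts, Finset.card_eq_three.2 ⟨x, y, z, hxy, hxz, hzy.symm, rfl⟩] at h3
    omega
  · simp [hxy.symm, hy]
  · simp [hxz.symm, hzy, hz]

/-- Of two distinct edges of a tile, one can be oriented as an arc whose head avoids the other. -/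
theorem exists_arc_head_avoiding (hK : IsTileCopy r R K) (hR : DigraphLoopless R) {x y z w : W}
    (hx : x ∈ K.1) (hy : y ∈ K.1) (hz : z ∈ K.1) (hw : w ∈ K.1) (hxy : x ≠ y) (hzw : z ≠ w)
    (hne : s(x, y) ≠ s(z, w)) :
    ∃ u p z' w', (u, p) ∈ K.2 ∧ p ≠ u ∧ p ≠ z' ∧ p ≠ w' ∧
      ((s(u, p) = s(x, y) ∧ s(z', w') = s(z, w)) ∨
        (s(u, p) = s(z, w) ∧ s(z', w') = s(x, y))) := by
  have key : ∀ {x y z w : W}, x ∈ K.1 → y ∈ K.1 → z ∈ K.1 → w ∈ K.1 → x ≠ y → z ≠ w →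
      s(x, y) ≠ s(z, w) → (x, y) ∈ K.2 → (z, w) ∈ K.2 →
      ∃ u p z' w', (u, p) ∈ K.2 ∧ p ≠ u ∧ p ≠ z' ∧ p ≠ w' ∧
      ((s(u, p) = s(x, y) ∧ s(z', w') = s(z, w)) ∨
        (s(u, p) = s(z, w) ∧ s(z', w') = s(x, y))) := by
    intro x y z w hx hy hz hw hxy hzw hne h1 h2
    by_cases hyzw : y ≠ z ∧ y ≠ w
    · exact ⟨x, y, z, w, h1, hxy.symm, hyzw.1, hyzw.2, Or.inl ⟨rfl, rfl⟩⟩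
    by_cases hwxy : w ≠ x ∧ w ≠ y
    · exact ⟨z, w, x, y, h2, hzw.symm, hwxy.1, hwxy.2, Or.inr ⟨rfl, rfl⟩⟩
    -- Each head now lies on the other edge. Unless the heads coincide, the two arcs are reverses of
    -- each other, so the edges would be equal.
    have hyw : y = w := by
      by_contra h
      have h3 : y = z := by by_contra h'; exact hyzw ⟨h', h⟩
      have h4 : w = x := by by_contra h'; exact hwxy ⟨h', fun h'' => h h''.symm⟩
      subst h3 h4
      exact hne Sym2.eq_swap
    subst hyw
    have hxz : x ≠ z := by rintro rfl; exact hne rfl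
    rcases hK.arc_or_arc_of_in_in hR hx hy hz hxy hzw hxz with h | h
    · exact ⟨y, x, z, y, h, hxy, hxz, hxy, Or.inl ⟨Sym2.eq_swap, rfl⟩⟩
    · exact ⟨y, z, x, y, h, hzw, hxz.symm, hzw, Or.inr ⟨Sym2.eq_swap, rfl⟩⟩
  rcases hK.base_complete x hx y hy hxy with h1 | h1 <;>
    rcases hK.base_complete z hz w hw hzw with h2 | h2
  · exact key hx hy hz hw hxy hzw hne h1 h2
  · rw [Sym2.eq_swap (a := z)] at hne ⊢
    exact key hx hy hw hz hxy hzw.symm hne h1 h2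
  · rw [Sym2.eq_swap (a := x)] at hne ⊢
    exact key hy hx hz hw hxy.symm hzw hne h1 h2
  · rw [Sym2.eq_swap (a := x), Sym2.eq_swap (a := z)] at hne ⊢
    exact key hy hx hw hz hxy.symm hzw.symm hne h1 h2

end IsTileCopy

/-! ### Rainbow cliques in a blow-up -/

section BlowUp

variable {V C W I : Type*} {G : SimpleGraph V} {c : G.EdgeLabeling C} {D : Digraph V}
  {R : Digraph W} {r : ℕ} {φ : W → I → V}

/-- A union bound. For two edges of the tile, take an arc from `u` to `p` whose head is not on the
other edge. Once all choices except `h p` are fixed, at most one value of `h p` makes the colours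
agree, because arcs out of one vertex have distinct colours. Each of the at most `r ^ 4` pairs thus
spoils at most a fraction `1 / (r ^ 4 + 1)` of the transversals. -/
theorem exists_rainbow_transversal [Fintype W]
    (hD : IsOutRainbow c D) (hR : DigraphLoopless R) (hφ : ∀ v, Function.Injective (φ v))
    (hRD : ∀ v w k l, R.Adj v w → D.Adj (φ v k) (φ w l))
    {K : Finset W × Finset (W × W)} (hK : IsTileCopy r R K) (Y : W → Finset I)
    (hY : ∀ v, r ^ 4 < (Y v).card) :
    ∃ h : W → I, (∀ v, h v ∈ Y v) ∧ ∀ x ∈ K.1, ∀ y ∈ K.1, ∀ z ∈ K.1, ∀ w ∈ K.1, x ≠ y → z ≠ w →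
      s(x, y) ≠ s(z, w) → pairColour c s(φ x (h x), φ y (h y)) ≠
        pairColour c s(φ z (h z), φ w (h w)) := by
  classical
  choose X hXY hX using fun v => Finset.exists_subset_card_eq
    (show r ^ 4 + 1 ≤ (Y v).card from hY v)
  let q : Finset (W × W × W × W) := (K.1 ×ˢ K.1 ×ˢ K.1 ×ˢ K.1).filter
    fun a => a.1 ≠ a.2.1 ∧ a.2.2.1 ≠ a.2.2.2 ∧ s(a.1, a.2.1) ≠ s(a.2.2.1, a.2.2.2)
  let bad : W × W × W × W → Finset (W → I) := fun a => (Fintype.piFinset X).filter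
    fun h => pairColour c s(φ a.1 (h a.1), φ a.2.1 (h a.2.1)) =
      pairColour c s(φ a.2.2.1 (h a.2.2.1), φ a.2.2.2 (h a.2.2.2))
  have hbad : ∀ a ∈ q, (bad a).card * (r ^ 4 + 1) ≤ (Fintype.piFinset X).card := by
    rintro ⟨x, y, z, w⟩ ha
    simp only [q, Finset.mem_filter, Finset.mem_product] at ha
    obtain ⟨⟨hx, hy, hz, hw⟩, hxy, hzw, hne⟩ := ha
    obtain ⟨u, p, z', w', hup, hpu, hpz, hpw, hcases⟩ :=
      hK.exists_arc_head_avoiding hR hx hy hz hw hxy hzw hne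
    have hcol : ∀ h ∈ bad (x, y, z, w), pairColour c s(φ u (h u), φ p (h p)) =
        pairColour c s(φ z' (h z'), φ w' (h w')) := by
      intro h hh
      have hh := (Finset.mem_filter.1 hh).2
      have hmap : ∀ a b, s(φ a (h a), φ b (h b)) = Sym2.map (fun v => φ v (h v)) s(a, b) :=
        fun a b => by simp
      simp only [hmap] at hh ⊢
      rcases hcases with ⟨h1, h2⟩ | ⟨h1, h2⟩
      · rw [h1, h2, hh]
      · rw [h1, h2, hh]
    rw [← hX p, ← Finset.card_product]
    -- Overwriting the value at `p` loses no information on bad transversals, since it is determined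
    -- by the remaining values.
    refine Finset.card_le_card_of_injOn (fun a => Function.update a.1 p a.2) ?_ ?_
    · rintro ⟨h, k⟩ hk
      simp only [Finset.coe_product, Set.mem_prod, Finset.mem_coe] at hk
      have hh := Fintype.mem_piFinset.1 (Finset.mem_filter.1 hk.1).1
      simp only [Finset.mem_coe, Fintype.mem_piFinset]
      intro v
      by_cases hv : v = p
      · subst hv; simpa using hk.2
      · simpa [Function.update_of_ne hv] using hh v
    · rintro ⟨h, k⟩ hk ⟨h', k'⟩ hk' heq
      simp only [Finset.coe_product, Set.mem_prod, Finset.mem_coe] at hk hk' heq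
      have hkk : k = k' := by simpa using congrFun heq p
      have hoff : ∀ v, v ≠ p → h v = h' v := fun v hv => by
        simpa [Function.update_of_ne hv] using congrFun heq v
      have h1 := hcol h hk.1
      have h2 := hcol h' hk'.1
      rw [← hoff u hpu.symm, ← hoff z' hpz.symm, ← hoff w' hpw.symm] at h2
      have hadj := hK.arcs_adj _ hup
      have h3 := hφ p (hD.eq_of_colour (hRD _ _ (h u) (h p) hadj) (hRD _ _ (h u) (h' p) hadj)
        (h1.trans h2.symm))
      have hhh : h = h' := by
        funext v
        by_cases hv : v = p
        · rw [hv, h3]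
        · exact hoff v hv
      rw [hkk, hhh]
  have hq : q.card ≤ r ^ 4 := by
    refine (Finset.card_filter_le _ _).trans ?_
    simp only [Finset.card_product, hK.card_verts]
    exact le_of_eq (by ring)
  have hpos : 0 < (Fintype.piFinset X).card := by
    rw [Fintype.card_piFinset]
    exact Finset.prod_pos fun v _ => by rw [hX]; omega
  have hunion : (q.biUnion bad).card < (Fintype.piFinset X).card := by
    have h1 : (q.biUnion bad).card * (r ^ 4 + 1) ≤ r ^ 4 * (Fintype.piFinset X).card := by
      calc (q.biUnion bad).card * (r ^ 4 + 1) ≤ (∑ a ∈ q, (bad a).card) * (r ^ 4 + 1) :=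
            Nat.mul_le_mul_right _ Finset.card_biUnion_le
        _ ≤ ∑ a ∈ q, (Fintype.piFinset X).card := by
            rw [Finset.sum_mul]; exact Finset.sum_le_sum hbad
        _ ≤ _ := by
            rw [Finset.sum_const, smul_eq_mul]; exact Nat.mul_le_mul_right _ hq
    by_contra! hcon
    nlinarith [Nat.mul_le_mul_right (r ^ 4 + 1) hcon]
  obtain ⟨h, hh, hhbad⟩ := Finset.exists_mem_notMem_of_card_lt_card hunion
  have hh' := Fintype.mem_piFinset.1 hh
  refine ⟨h, fun v => hXY v (hh' v), fun x hx y hy z hz w hw hxy hzw hne heq => hhbad ?_⟩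
  refine Finset.mem_biUnion.2 ⟨(x, y, z, w), ?_, ?_⟩
  · simp only [q, Finset.mem_filter, Finset.mem_product]
    exact ⟨⟨hx, hy, hz, hw⟩, hxy, hzw, hne⟩
  · exact Finset.mem_filter.2 ⟨hh, heq⟩

open Classical in
theorem isRainbowClique_image_transversal
    (hD : IsOutRainbow c D) (hφ : Function.Injective fun a : W × I => φ a.1 a.2)
    (hRD : ∀ v w k l, R.Adj v w → D.Adj (φ v k) (φ w l))
    {K : Finset W × Finset (W × W)} (hK : IsTileCopy r R K) {h : W → I}
    (hh : ∀ x ∈ K.1, ∀ y ∈ K.1, ∀ z ∈ K.1, ∀ w ∈ K.1, x ≠ y → z ≠ w →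
      s(x, y) ≠ s(z, w) → pairColour c s(φ x (h x), φ y (h y)) ≠
        pairColour c s(φ z (h z), φ w (h w))) :
    IsRainbowClique c r (K.1.image fun v => φ v (h v)) := by
  have hinj : Function.Injective fun v => φ v (h v) := fun v w hvw =>
    (Prod.ext_iff.1 (hφ (a₁ := (v, h v)) (a₂ := (w, h w)) hvw)).1
  refine ⟨⟨?_, ?_⟩, ?_⟩
  · intro a ha b hb hab
    obtain ⟨x, hx, rfl⟩ := Finset.mem_image.1 ha
    obtain ⟨y, hy, rfl⟩ := Finset.mem_image.1 hb
    have hxy : x ≠ y := by rintro rfl; exact hab rfl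
    rcases hK.base_complete x hx y hy hxy with h1 | h1
    · exact hD.adj (hRD _ _ _ _ (hK.arcs_adj _ h1))
    · exact (hD.adj (hRD _ _ _ _ (hK.arcs_adj _ h1))).symm
  · rw [Finset.card_image_of_injective _ hinj, hK.card_verts]
  · have hedge : ∀ e : G.edgeSet, (∀ v ∈ (e : Sym2 V), v ∈ K.1.image fun v => φ v (h v)) →
        ∃ x ∈ K.1, ∃ y ∈ K.1, x ≠ y ∧ (e : Sym2 V) = s(φ x (h x), φ y (h y)) := by
      rintro ⟨e, he⟩ hmem
      induction e using Sym2.ind with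
      | _ a b =>
        obtain ⟨x, hx, rfl⟩ := Finset.mem_image.1 (hmem a (Sym2.mem_mk_left _ _))
        obtain ⟨y, hy, rfl⟩ := Finset.mem_image.1 (hmem b (Sym2.mem_mk_right _ _))
        refine ⟨x, hx, y, hy, ?_, rfl⟩
        rintro rfl
        exact G.ne_of_adj he rfl
    intro e f he hf hef
    obtain ⟨x, hx, y, hy, hxy, hexy⟩ := hedge e he
    obtain ⟨z, hz, w, hw, hzw, hfzw⟩ := hedge f hf
    by_contra hne
    refine hh x hx y hy z hz w hw hxy hzw (fun hs => hne (Subtype.ext ?_)) ?_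
    · rw [hexy, hfzw]
      have := congrArg (Sym2.map fun v => φ v (h v)) hs
      simpa using this
    · rw [← hexy, ← hfzw, pairColour_eq_some, pairColour_eq_some, hef]

open Classical in
-- Greedy embedding: the clique for each tile is a transversal of the still unused vertices. A part
-- loses one vertex per tile through it, so more than `r ^ 4` remain available throughout.
theorem exists_rainbow_tiling_of_multiset [Fintype W] [Fintype I] (hr : 0 < r)
    (hD : IsOutRainbow c D) (hR : DigraphLoopless R)
    (hφ : Function.Injective fun a : W × I => φ a.1 a.2)
    (hRD : ∀ v w k l, R.Adj v w → D.Adj (φ v k) (φ w l))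
    (m : Multiset (Finset W × Finset (W × W))) (hm : ∀ K ∈ m, IsTileCopy r R K)
    (hcount : ∀ v, m.countP (fun K => v ∈ K.1) + r ^ 4 < Fintype.card I) :
    ∃ T : Finset (Finset V), IsRainbowCliqueTiling c r T ∧ T.card = m.card ∧
      (∀ S ∈ T, ∀ u ∈ S, ∃ v k, u = φ v k) ∧
      ∀ v, (Finset.univ.filter fun k => ∃ S ∈ T, φ v k ∈ S).card
        ≤ m.countP (fun K => v ∈ K.1) := by
  induction m using Multiset.induction_on with
  | empty => exact ⟨∅, ⟨by simp, by simp⟩, by simp, by simp, by simp⟩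
  | cons K m ih =>
    obtain ⟨T, hT, hTcard, hTφ, hTused⟩ := ih (fun K' hK' => hm K' (Multiset.mem_cons_of_mem hK'))
      fun v => lt_of_le_of_lt (Nat.add_le_add_right (Multiset.countP_le_of_le _
        (Multiset.le_cons_self m K)) _) (hcount v)
    have hK := hm K (Multiset.mem_cons_self K m)
    let used : W → Finset I := fun v => Finset.univ.filter fun k => ∃ S ∈ T, φ v k ∈ S
    have hφv : ∀ v, Function.Injective (φ v) := fun v k l hkl =>
      (Prod.ext_iff.1 (hφ (a₁ := (v, k)) (a₂ := (v, l)) hkl)).2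
    obtain ⟨h, hhY, hh⟩ := exists_rainbow_transversal hD hR hφv hRD hK (fun v => (used v)ᶜ)
      (fun v => by
        have h1 := hcount v
        have h2 : (used v).card ≤ _ := hTused v
        have h3 := Multiset.countP_le_of_le (fun K => v ∈ K.1) (Multiset.le_cons_self m K)
        rw [Finset.card_compl]
        omega)
    have hS := isRainbowClique_image_transversal hD hφ hRD hK hh
    set S := K.1.image fun v => φ v (h v) with hSdef
    have hdisj : ∀ S' ∈ T, Disjoint S S' := by
      intro S' hS'
      rw [Finset.disjoint_left]
      intro a ha haS'
      obtain ⟨v, -, rfl⟩ := Finset.mem_image.1 ha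
      have := hhY v
      simp only [used, Finset.mem_compl, Finset.mem_filter, Finset.mem_univ, true_and] at this
      exact this ⟨S', hS', haS'⟩
    have hSne : S.Nonempty := by
      rw [← Finset.card_pos, hS.1.card_eq]; exact hr
    have hST : S ∉ T := fun hmem => hSne.ne_empty (Finset.disjoint_self_iff_empty S |>.1 (hdisj S hmem))
    refine ⟨insert S T, ⟨?_, ?_⟩, ?_, ?_, ?_⟩
    · intro S' hS'
      rcases Finset.mem_insert.1 hS' with rfl | hS'
      · exact hS
      · exact hT.1 _ hS'
    · intro S₁ h₁ S₂ h₂ hne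
      rcases Finset.mem_insert.1 h₁ with rfl | h₁ <;> rcases Finset.mem_insert.1 h₂ with h₂ | h₂
      · exact (hne h₂.symm).elim
      · exact hdisj _ h₂
      · rw [h₂]; exact (hdisj _ h₁).symm
      · exact hT.2 _ h₁ _ h₂ hne
    · rw [Finset.card_insert_of_notMem hST, hTcard, Multiset.card_cons]
    · intro S' hS' u hu
      rcases Finset.mem_insert.1 hS' with rfl | hS'
      · obtain ⟨v, -, rfl⟩ := Finset.mem_image.1 hu
        exact ⟨v, h v, rfl⟩
      · exact hTφ _ hS' u hu
    · intro v
      rw [Multiset.countP_cons]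
      have hsub : (Finset.univ.filter fun k => ∃ S' ∈ insert S T, φ v k ∈ S') ⊆
          used v ∪ if v ∈ K.1 then {h v} else ∅ := by
        intro k hk
        obtain ⟨S', hS', hkS'⟩ := (Finset.mem_filter.1 hk).2
        rcases Finset.mem_insert.1 hS' with rfl | hS'
        · obtain ⟨w, hw, hwk⟩ := Finset.mem_image.1 hkS'
          obtain ⟨rfl, rfl⟩ := Prod.ext_iff.1 (hφ (a₁ := (w, h w)) (a₂ := (v, k)) hwk)
          simp [hw]
        · exact Finset.mem_union_left _
            (Finset.mem_filter.2 ⟨Finset.mem_univ _, S', hS', hkS'⟩)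
      refine (Finset.card_le_card hsub).trans ((Finset.card_union_le _ _).trans ?_)
      refine add_le_add (hTused v) ?_
      split_ifs <;> simp

end BlowUp

/-! ### Rounding a fractional tiling -/

section Weights

variable {W : Type*} [Fintype W] {r : ℕ} {R : Digraph W}

theorem isTileCopy_of_mem_tileCopies {K : Finset W × Finset (W × W)} (h : K ∈ tileCopies r R) :
    IsTileCopy r R K := by
  classical
  exact (Finset.mem_filter.1 h).2

open Classical in
-- Take each copy `K` that avoids `F` with multiplicity `⌊B * ω K⌋₊`. The total weight is `|W| / r`,
-- the copies meeting `F` carry at most `|F|` of it, and rounding loses at most one per conceivable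
-- copy.
theorem exists_multiset_of_hasPerfectFractionalTiling
    (hR : HasPerfectFractionalTiling r R) (F : Finset W) (B : ℕ) :
    ∃ m : Multiset (Finset W × Finset (W × W)),
      (∀ K ∈ m, IsTileCopy r R K ∧ Disjoint K.1 F) ∧
      (∀ v, m.countP (fun K => v ∈ K.1) ≤ B) ∧
      B * Fintype.card W ≤
        r * (m.card + B * F.card + Fintype.card (Finset W × Finset (W × W))) := by
  obtain ⟨ω, ⟨hω01, -⟩, hω⟩ := hR
  have hω0 : ∀ K ∈ tileCopies r R, 0 ≤ ω K := fun K hK => (hω01 K hK).1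
  let 𝒦 := (tileCopies r R).filter fun K => Disjoint K.1 F
  let m : Multiset (Finset W × Finset (W × W)) :=
    ∑ K ∈ 𝒦, Multiset.replicate ⌊B * ω K⌋₊ K
  have hcard : m.card = ∑ K ∈ 𝒦, ⌊B * ω K⌋₊ := by
    simp [m]
  have hcount : ∀ v, m.countP (fun K => v ∈ K.1) =
      ∑ K ∈ 𝒦.filter (fun K => v ∈ K.1), ⌊B * ω K⌋₊ := by
    intro v
    have h1 := map_sum (Multiset.countPAddMonoidHom
      (fun K : Finset W × Finset (W × W) => v ∈ K.1))
      (fun K => Multiset.replicate ⌊B * ω K⌋₊ K) 𝒦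
    simp only [Multiset.coe_countPAddMonoidHom] at h1
    rw [show m = ∑ K ∈ 𝒦, Multiset.replicate ⌊B * ω K⌋₊ K from rfl, h1,
      Finset.sum_filter (s := 𝒦) (p := fun K => v ∈ K.1)]
    refine Finset.sum_congr rfl fun K _ => ?_
    split_ifs with hv
    · rw [Multiset.countP_eq_card.2, Multiset.card_replicate]
      intro a ha
      rw [Multiset.eq_of_mem_replicate ha]; exact hv
    · rw [Multiset.countP_eq_zero]
      intro a ha
      rw [Multiset.eq_of_mem_replicate ha]; exact hv
  refine ⟨m, ?_, ?_, ?_⟩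
  · intro K hK
    obtain ⟨K', hK', hKK'⟩ := Multiset.mem_sum.1 hK
    obtain rfl := Multiset.eq_of_mem_replicate hKK'
    obtain ⟨h1, h2⟩ := Finset.mem_filter.1 hK'
    exact ⟨isTileCopy_of_mem_tileCopies h1, h2⟩
  · intro v
    rw [hcount]
    have h1 : (∑ K ∈ 𝒦.filter (fun K => v ∈ K.1), (⌊B * ω K⌋₊ : ℝ)) ≤ B := by
      calc (∑ K ∈ 𝒦.filter (fun K => v ∈ K.1), (⌊B * ω K⌋₊ : ℝ))
          ≤ ∑ K ∈ 𝒦.filter (fun K => v ∈ K.1), B * ω K := by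
            refine Finset.sum_le_sum fun K hK => Nat.floor_le ?_
            exact mul_nonneg (Nat.cast_nonneg _)
              (hω0 K (Finset.mem_filter.1 (Finset.mem_filter.1 hK).1).1)
        _ ≤ ∑ K ∈ (tileCopies r R).filter (fun K => v ∈ K.1), B * ω K := by
            refine Finset.sum_le_sum_of_subset_of_nonneg
              (Finset.filter_subset_filter _ (Finset.filter_subset _ _)) fun K hK _ => ?_
            exact mul_nonneg (Nat.cast_nonneg _) (hω0 K (Finset.mem_filter.1 hK).1)
        _ = B := by
            rw [← Finset.mul_sum]
            have := hω v
            rw [tileWeightAt] at this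
            rw [this, mul_one]
    exact_mod_cast h1
  · have htotal : (Fintype.card W : ℝ) = r * ∑ K ∈ tileCopies r R, ω K := by
      calc (Fintype.card W : ℝ) = ∑ v, tileWeightAt r R ω v := by simp [hω]
        _ = ∑ K ∈ tileCopies r R, ∑ v : W, if v ∈ K.1 then ω K else 0 := by
            simp only [tileWeightAt, Finset.sum_filter]
            exact Finset.sum_comm
        _ = _ := by
            rw [Finset.mul_sum]
            refine Finset.sum_congr rfl fun K hK => ?_
            simp [(isTileCopy_of_mem_tileCopies hK).card_verts]
    have hmeet : ∑ K ∈ (tileCopies r R).filter (fun K => ¬ Disjoint K.1 F), ω K ≤ F.card := by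
      calc ∑ K ∈ (tileCopies r R).filter (fun K => ¬ Disjoint K.1 F), ω K
          ≤ ∑ K ∈ tileCopies r R, ∑ v ∈ F, if v ∈ K.1 then ω K else 0 := by
            rw [Finset.sum_filter]
            refine Finset.sum_le_sum fun K hK => ?_
            have hnn : ∀ v ∈ F, 0 ≤ if v ∈ K.1 then ω K else 0 := fun v _ => by
              split_ifs
              exacts [hω0 K hK, le_rfl]
            by_cases hd : Disjoint K.1 F
            · rw [if_neg (not_not.2 hd)]
              exact Finset.sum_nonneg hnn
            · rw [if_pos hd]
              obtain ⟨v, hvK, hvF⟩ := Finset.not_disjoint_iff.1 hd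
              refine le_trans ?_ (Finset.single_le_sum hnn hvF)
              simp [hvK]
        _ = ∑ v ∈ F, tileWeightAt r R ω v := by
            rw [Finset.sum_comm]
            simp only [tileWeightAt, Finset.sum_filter]
        _ = F.card := by simp [hω]
    have hfloor : B * ∑ K ∈ 𝒦, ω K ≤ m.card + Fintype.card (Finset W × Finset (W × W)) := by
      rw [hcard, Finset.mul_sum]
      push_cast
      calc ∑ K ∈ 𝒦, B * ω K ≤ ∑ K ∈ 𝒦, ((⌊B * ω K⌋₊ : ℝ) + 1) :=
            Finset.sum_le_sum fun K _ => (Nat.lt_floor_add_one _).le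
        _ = ∑ K ∈ 𝒦, (⌊B * ω K⌋₊ : ℝ) + 𝒦.card := by simp [Finset.sum_add_distrib]
        _ ≤ _ := by
            have : (𝒦.card : ℝ) ≤ Fintype.card (Finset W × Finset (W × W)) := by
              exact_mod_cast Finset.card_le_univ _
            linarith
    have hsplit := Finset.sum_filter_add_sum_filter_not (tileCopies r R)
      (fun K => Disjoint K.1 F) ω
    have hB : (0 : ℝ) ≤ B := Nat.cast_nonneg _
    have hfin : (B : ℝ) * Fintype.card W ≤
        r * (m.card + B * F.card + Fintype.card (Finset W × Finset (W × W))) := by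
      rw [htotal, ← hsplit]
      have h1 := mul_le_mul_of_nonneg_left hmeet hB
      have h2 : (B : ℝ) * (∑ K ∈ 𝒦, ω K +
          ∑ K ∈ (tileCopies r R).filter (fun K => ¬ Disjoint K.1 F), ω K) ≤
          m.card + B * F.card + Fintype.card (Finset W × Finset (W × W)) := by linarith
      calc _ = (r : ℝ) * (B * (∑ K ∈ 𝒦, ω K +
          ∑ K ∈ (tileCopies r R).filter (fun K => ¬ Disjoint K.1 F), ω K)) := by ring
        _ ≤ _ := mul_le_mul_of_nonneg_left h2 (Nat.cast_nonneg _)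
    exact_mod_cast hfin

end Weights

/-! ### The exchange, and the division into blocks -/

theorem IsTileCopy.of_disjoint {W : Type*} {r : ℕ} {R R' : Digraph W} {F : Finset W}
    (hRR' : ∀ v w, v ∉ F → R'.Adj v w → R.Adj v w) {K : Finset W × Finset (W × W)}
    (hK : IsTileCopy r R' K) (hF : Disjoint K.1 F) : IsTileCopy r R K where
  card_verts := hK.card_verts
  arcs_mem := hK.arcs_mem
  arcs_adj a ha := hRR' _ _ (Finset.disjoint_left.1 hF (hK.arcs_mem a ha).1) (hK.arcs_adj a ha)
  base_complete := hK.base_complete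
  le_outDeg := hK.le_outDeg

/-- `T₁` contains every old clique that meets the blow-up, so it can be replaced by any tiling
inside the blow-up; `hsize` says that the rounded fractional tiling has more members. -/
theorem exists_larger_tiling {V C W I : Type*} [Fintype W] [Fintype I]
    {G : SimpleGraph V} {c : G.EdgeLabeling C} {D : Digraph V} {R R' : Digraph W} {r : ℕ}
    {φ : W → I → V} (hr : 0 < r) (hD : IsOutRainbow c D) (hR : DigraphLoopless R)
    (hφ : Function.Injective fun a : W × I => φ a.1 a.2)
    (hRD : ∀ v w k l, R.Adj v w → D.Adj (φ v k) (φ w l))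
    {F : Finset W} (hRR' : ∀ v w, v ∉ F → R'.Adj v w → R.Adj v w)
    (hfrac : HasPerfectFractionalTiling r R')
    {T₀ T₁ : Finset (Finset V)} (hT₀ : IsRainbowCliqueTiling c r T₀) (hT₁ : T₁ ⊆ T₀)
    (hT₁φ : ∀ v k, ∀ S ∈ T₀, φ v k ∈ S → S ∈ T₁) {B : ℕ} (hB : B + r ^ 4 < Fintype.card I)
    (hsize : r * (T₁.card + B * F.card + Fintype.card (Finset W × Finset (W × W))) <
      B * Fintype.card W) :
    ∃ T : Finset (Finset V), IsRainbowCliqueTiling c r T ∧ T₀.card < T.card := by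
  classical
  obtain ⟨m, hm, hmcount, hmcard⟩ :=
    exists_multiset_of_hasPerfectFractionalTiling hfrac F B
  obtain ⟨T, hT, hTcard, hTφ, -⟩ := exists_rainbow_tiling_of_multiset hr hD hR hφ hRD m
    (fun K hK => (hm K hK).1.of_disjoint hRR' (hm K hK).2)
    (fun v => lt_of_le_of_lt (Nat.add_le_add_right (hmcount v) _) hB)
  have hlt : T₁.card < m.card := by
    have h := Nat.lt_of_mul_lt_mul_left (hsize.trans_le hmcard)
    omega
  have hdisj : ∀ S ∈ T₀ \ T₁, ∀ S' ∈ T, Disjoint S S' := by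
    intro S hS S' hS'
    obtain ⟨hS0, hS1⟩ := Finset.mem_sdiff.1 hS
    rw [Finset.disjoint_left]
    intro u hu hu'
    obtain ⟨v, k, rfl⟩ := hTφ S' hS' u hu'
    exact hS1 (hT₁φ v k S hS0 hu)
  refine ⟨T₀ \ T₁ ∪ T, ⟨?_, ?_⟩, ?_⟩
  · intro S hS
    rcases Finset.mem_union.1 hS with hS | hS
    · exact hT₀.1 S (Finset.mem_sdiff.1 hS).1
    · exact hT.1 S hS
  · intro S hS S' hS' hne
    rcases Finset.mem_union.1 hS with hS | hS <;> rcases Finset.mem_union.1 hS' with hS' | hS'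
    · exact hT₀.2 S (Finset.mem_sdiff.1 hS).1 S' (Finset.mem_sdiff.1 hS').1 hne
    · exact hdisj S hS S' hS'
    · exact (hdisj S' hS' S hS).symm
    · exact hT.2 S hS S' hS' hne
  · have hd : Disjoint (T₀ \ T₁) T := by
      rw [Finset.disjoint_left]
      intro S hS hS'
      have h0 : S = ∅ := Finset.disjoint_self_iff_empty S |>.1 (hdisj S hS S hS')
      have h1 := (hT.1 S hS').1.card_eq
      rw [h0, Finset.card_empty] at h1
      omega
    rw [Finset.card_union_of_disjoint hd, Finset.card_sdiff_of_subset hT₁, hTcard]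
    have := Finset.card_le_card hT₁
    omega

/-- The vertices not covered by a tiling and its members are cut into disjoint blocks of size `r`,
with fewer than `r` vertices left over. The blocks in `U` are the uncovered ones. -/
theorem exists_blocks.{u} {V : Type u} [Fintype V] {r : ℕ} (hr : 0 < r) (T : Finset (Finset V))
    (hcard : ∀ S ∈ T, S.card = r) (hdisj : ∀ S ∈ T, ∀ S' ∈ T, S ≠ S' → Disjoint S S') :
    ∃ (β : Type u) (_ : Fintype β) (b : β → Fin r → V) (U : Finset β),
      (Function.Injective fun a : β × Fin r => b a.1 a.2) ∧
      r * Fintype.card β ≤ Fintype.card V ∧ Fintype.card V < r * Fintype.card β + r ∧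
      U.card = numUncovered T / r ∧ (∀ y ∈ U, ∀ i, ∀ S ∈ T, b y i ∉ S) ∧
      ∀ y ∉ U, ∃ S ∈ T, ∀ i, b y i ∈ S := by
  classical
  set u := numUncovered T with hu
  let X : Finset V := Finset.univ.filter fun v => ∀ S ∈ T, v ∉ S
  have hX : X.card = u := by
    rw [hu, numUncovered, ← Set.ncard_coe_finset]
    congr 1
    ext v; simp [X]
  have hle : u / r * r ≤ u := Nat.div_mul_le_self _ _
  let eX : Fin u ≃ X := (X.equivFinOfCardEq hX).symm
  let eT : ∀ S : T, Fin r ≃ S.1 := fun S => (S.1.equivFinOfCardEq (hcard S.1 S.2)).symm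
  let b : T ⊕ Fin (u / r) → Fin r → V := fun y i =>
    Sum.elim (fun S => ((eT S i : S.1) : V))
      (fun k => ((eX (Fin.castLE hle (finProdFinEquiv (k, i))) : X) : V)) y
  have hbT : ∀ (S : T) i, b (Sum.inl S) i ∈ S.1 := fun S i => (eT S i).2
  have hbX : ∀ k i, b (Sum.inr k) i ∈ X := fun k i => (eX _).2
  have hbX' : ∀ k i, ∀ S ∈ T, b (Sum.inr k) i ∉ S := fun k i =>
    (Finset.mem_filter.1 (hbX k i)).2
  have hV : Fintype.card V = T.card * r + u := by
    have h1 : (T.biUnion id).card = T.card * r := by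
      rw [Finset.card_biUnion (t := id) (fun S hS S' hS' h => hdisj S hS S' hS' h)]
      exact Finset.sum_const_nat hcard
    have h2 : X = (T.biUnion id)ᶜ := by
      ext v; simp [X]
    have h3 := Finset.card_add_card_compl (T.biUnion id)
    rw [← h2, hX, h1] at h3
    exact h3.symm
  have hβ : Fintype.card (T ⊕ Fin (u / r)) = T.card + u / r := by simp
  refine ⟨T ⊕ Fin (u / r), inferInstance, b, Finset.univ.map ⟨Sum.inr, Sum.inr_injective⟩,
    ?_, ?_, ?_, ?_, ?_, ?_⟩
  · rintro ⟨S | k, i⟩ ⟨S' | k', i'⟩ h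
    · have hSS' : S = S' := by
        by_contra hne
        have h1 := hdisj S.1 S.2 S'.1 S'.2 fun h' => hne (Subtype.ext h')
        refine Finset.disjoint_left.1 h1 (hbT S i) ?_
        simp only at h
        rw [h]; exact hbT S' i'
      subst hSS'
      have h2 : eT S i = eT S i' := Subtype.ext h
      rw [(eT S).injective h2]
    · simp only at h
      exact (hbX' k' i' S.1 S.2 (h ▸ hbT S i)).elim
    · simp only at h
      exact (hbX' k i S'.1 S'.2 (h ▸ hbT S' i')).elim
    · have h1 := Fin.castLE_injective hle (eX.injective (Subtype.ext h))
      obtain ⟨rfl, rfl⟩ := Prod.ext_iff.1 (finProdFinEquiv.injective h1)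
      rfl
  · rw [hβ, hV, mul_add, mul_comm r, mul_comm r]; omega
  · rw [hβ, hV, mul_add, mul_comm r]
    have := Nat.lt_mul_div_succ u hr
    rw [mul_add, mul_one] at this
    omega
  · simp
  · intro y hy i S hS
    obtain ⟨k, -, rfl⟩ := Finset.mem_map.1 hy
    exact hbX' k i S hS
  · rintro (S | k) hy
    · exact ⟨S.1, S.2, hbT S⟩
    · simp at hy

/-! ### Out-degrees in a sampled digraph -/

section SampledDigraph

variable {V β : Type*} {r t : ℕ}

/-- The block of a vertex when `Fin t` is cut into consecutive blocks of size `r`. -/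
def blockIdx (r : ℕ) {t : ℕ} (v : Fin t) : Fin (t / r + 1) :=
  ⟨v / r, Nat.lt_succ_of_le (Nat.div_le_div_right v.2.le)⟩

/-- The position of a vertex in its block when `Fin t` is cut into blocks of size `r`. -/
def blockPos (hr : 0 < r) (v : Fin t) : Fin r :=
  ⟨v % r, Nat.mod_lt _ hr⟩

theorem eq_of_blockIdx_eq_of_blockPos_eq (hr : 0 < r) {v w : Fin t}
    (h₁ : blockIdx r v = blockIdx r w) (h₂ : blockPos hr v = blockPos hr w) : v = w := by
  have h₁' : (v : ℕ) / r = w / r := congrArg Fin.val h₁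
  have h₂' : (v : ℕ) % r = w % r := congrArg Fin.val h₂
  refine Fin.ext ?_
  rw [← Nat.div_add_mod (v : ℕ) r, ← Nat.div_add_mod (w : ℕ) r, h₁', h₂']

/-- The digraph that `D` induces between different members of a sequence `x` of blocks. -/
def sampleDigraph (hr : 0 < r) (D : Digraph V) (b : β → Fin r → V) (x : Fin (t / r + 1) → β) :
    Digraph (Fin t) where
  Adj v w := blockIdx r v ≠ blockIdx r w ∧
    D.Adj (b (x (blockIdx r v)) (blockPos hr v)) (b (x (blockIdx r w)) (blockPos hr w))

open Classical in
/-- The number of out-neighbours of `u` in a block. -/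
noncomputable def outDegInBlock (D : Digraph V) (b : β → Fin r → V) (u : V) (y : β) : ℕ :=
  (Finset.univ.filter fun i => D.Adj u (b y i)).card

theorem outDegInBlock_le (D : Digraph V) (b : β → Fin r → V) (u : V) (y : β) :
    outDegInBlock D b u y ≤ r := by
  classical
  exact (Finset.card_le_univ _).trans (by simp)

/-- The loss `2 * r` accounts for two blocks: the one containing `v`, inside which no arcs are kept,
and the last one, which is cut short at `t`. -/
theorem sum_outDegInBlock_le_outDeg_sampleDigraph (hr : 0 < r) (D : Digraph V)
    (b : β → Fin r → V) (x : Fin (t / r + 1) → β) (v : Fin t) :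
    ∑ j, outDegInBlock D b (b (x (blockIdx r v)) (blockPos hr v)) (x j) ≤
      outDeg (sampleDigraph hr D b x) v + 2 * r := by
  classical
  set u := b (x (blockIdx r v)) (blockPos hr v) with hu
  let Z : Finset (Fin (t / r + 1) × Fin r) :=
    Finset.univ.filter fun a => D.Adj u (b (x a.1) a.2)
  have hsum : ∑ j, outDegInBlock D b u (x j) = Z.card := by
    simp only [Z, outDegInBlock, Finset.card_filter, Fintype.sum_prod_type]
  let N : Finset (Fin t) := Finset.univ.filter fun w => (sampleDigraph hr D b x).Adj v w
  have hN : outDeg (sampleDigraph hr D b x) v = N.card := by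
    rw [outDeg, ← Set.ncard_coe_finset]
    congr 1
    ext w; simp [N]
  have hsub : Z ⊆ N.image (fun w => (blockIdx r w, blockPos hr w)) ∪
      ({blockIdx r v, Fin.last _} : Finset (Fin (t / r + 1))) ×ˢ Finset.univ := by
    rintro ⟨j, i⟩ ha
    have ha : D.Adj u (b (x j) i) := (Finset.mem_filter.1 ha).2
    by_cases hj : j = blockIdx r v ∨ j = Fin.last _
    · refine Finset.mem_union_right _ ?_
      simpa using hj
    · push Not at hj
      have hjlt : (j : ℕ) < t / r := by
        have h1 := j.2
        have h2 : (j : ℕ) ≠ t / r := fun h => hj.2 (Fin.ext (by simpa using h))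
        omega
      have hw : (j : ℕ) * r + i < t := by
        have h1 : (j + 1) * r ≤ t / r * r := Nat.mul_le_mul_right _ hjlt
        have h2 := Nat.div_mul_le_self t r
        have h3 := i.2
        rw [add_mul, one_mul] at h1
        omega
      refine Finset.mem_union_left _ (Finset.mem_image.2 ⟨⟨j * r + i, hw⟩, ?_, ?_⟩)
      all_goals
        have hbi : blockIdx r (⟨j * r + i, hw⟩ : Fin t) = j := Fin.ext (by
          simp only [blockIdx]
          rw [mul_comm, Nat.mul_add_div hr, Nat.div_eq_of_lt i.2, add_zero])
        have hbp : blockPos hr (⟨j * r + i, hw⟩ : Fin t) = i := Fin.ext (by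
          simp only [blockPos]
          rw [mul_comm, Nat.mul_add_mod, Nat.mod_eq_of_lt i.2])
      · refine Finset.mem_filter.2 ⟨Finset.mem_univ _, ?_⟩
        simp only [sampleDigraph, hbi, hbp]
        exact ⟨hj.1.symm, ha⟩
      · rw [hbi, hbp]
  rw [hsum, hN]
  refine (Finset.card_le_card hsub).trans ((Finset.card_union_le _ _).trans ?_)
  refine add_le_add Finset.card_image_le ?_
  rw [Finset.card_product, Finset.card_univ, Fintype.card_fin]
  exact Nat.mul_le_mul_right _ Finset.card_le_two

theorem outDeg_le_sum_outDegInBlock [Fintype V] [Fintype β] (D : Digraph V) (b : β → Fin r → V)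
    (hb : Function.Injective fun a : β × Fin r => b a.1 a.2)
    (hcard : Fintype.card V < r * Fintype.card β + r) (u : V) :
    outDeg D u ≤ ∑ y, outDegInBlock D b u y + r := by
  classical
  let Z : Finset (β × Fin r) := Finset.univ.filter fun a => D.Adj u (b a.1 a.2)
  have hsum : ∑ y, outDegInBlock D b u y = Z.card := by
    simp only [Z, outDegInBlock, Finset.card_filter, Fintype.sum_prod_type]
  let N : Finset V := Finset.univ.filter fun w => D.Adj u w
  have hN : outDeg D u = N.card := by
    rw [outDeg, ← Set.ncard_coe_finset]
    congr 1
    ext w; simp [N]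
  let A : Finset V := Finset.univ.image fun a : β × Fin r => b a.1 a.2
  have hA : A.card = r * Fintype.card β := by
    rw [Finset.card_image_of_injective _ hb, Finset.card_univ, Fintype.card_prod,
      Fintype.card_fin, mul_comm]
  have hsub : N ⊆ Z.image (fun a => b a.1 a.2) ∪ Aᶜ := by
    intro w hw
    by_cases hwA : w ∈ A
    · obtain ⟨a, -, rfl⟩ := Finset.mem_image.1 hwA
      exact Finset.mem_union_left _ (Finset.mem_image_of_mem _
        (Finset.mem_filter.2 ⟨Finset.mem_univ _, (Finset.mem_filter.1 hw).2⟩))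
    · exact Finset.mem_union_right _ (Finset.mem_compl.2 hwA)
  rw [hsum, hN]
  refine (Finset.card_le_card hsub).trans ((Finset.card_union_le _ _).trans ?_)
  refine add_le_add Finset.card_image_le ?_
  rw [Finset.card_compl, hA]
  omega

open Classical in
/-- The vertices of out-degree less than `d`. -/
noncomputable def lowOutDeg {W : Type*} [Fintype W] (R : Digraph W) (d : ℝ) : Finset W :=
  Finset.univ.filter fun v => (outDeg R v : ℝ) < d

/-- Chebyshev's inequality, cleared of denominators. A vertex of low out-degree forces its sum over
the sampled blocks to fall at least `γ * t` below its mean; `sum_sq_sum_le` bounds how often this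
happens. -/
theorem sum_card_lowOutDeg_le [Fintype V] [Fintype β] (hr : 0 < r) (D : Digraph V)
    (b : β → Fin r → V) (hb : Function.Injective fun a : β × Fin r => b a.1 a.2)
    (hcard' : r * Fintype.card β ≤ Fintype.card V)
    (hcard : Fintype.card V < r * Fintype.card β + r) {δ γ : ℝ} (hγ : 0 < γ)
    (hD : ∀ u, (δ + 3 * γ) * Fintype.card V ≤ outDeg D u)
    (ht : 2 * r + 1 ≤ 2 * (γ * t)) (hβ : (t / r + 1) * r ≤ Fintype.card β) :
    (γ * t) ^ 2 * ∑ x : Fin (t / r + 1) → β, ((lowOutDeg (sampleDigraph hr D b x :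
        Digraph (Fin t)) (δ * t)).card : ℝ) ≤
      t * ((t / r + 1 : ℕ) * (r : ℝ) ^ 2 * (Fintype.card β : ℝ) ^ (t / r + 1)) := by
  classical
  set Q := t / r + 1 with hQ
  have hr' : (0 : ℝ) < r := by exact_mod_cast hr
  have hNpos : (0 : ℝ) < Fintype.card β := by
    have : 0 < Fintype.card β := lt_of_lt_of_le (Nat.mul_pos (Nat.succ_pos _) hr) hβ
    exact_mod_cast this
  set N : ℝ := (Fintype.card β : ℝ) with hN
  have hcardR : (r : ℝ) * N ≤ Fintype.card V := by rw [hN]; exact_mod_cast hcard'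
  have hβR : (Q : ℝ) * r ≤ N := by rw [hN]; exact_mod_cast hβ
  let μ : V → ℝ := fun u => (∑ y, (outDegInBlock D b u y : ℝ)) / N
  let g : Fin r → β → β → ℝ := fun i z y => outDegInBlock D b (b z i) y - μ (b z i)
  have hμ0 : ∀ u, 0 ≤ μ u := fun u => by positivity
  have hμr : ∀ u, μ u ≤ r := fun u => by
    rw [div_le_iff₀ hNpos]
    calc ∑ y, (outDegInBlock D b u y : ℝ) ≤ ∑ _y : β, (r : ℝ) :=
          Finset.sum_le_sum fun y _ => by exact_mod_cast outDegInBlock_le D b u y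
      _ = r * N := by simp [hN, mul_comm]
  have hg0 : ∀ i z, ∑ y, g i z y = 0 := fun i z => by
    simp only [g, Finset.sum_sub_distrib, Finset.sum_const, nsmul_eq_mul, Finset.card_univ]
    rw [← hN, mul_div_cancel₀ _ hNpos.ne', sub_self]
  have hgr : ∀ i z y, |g i z y| ≤ r := fun i z y => by
    have h1 : (outDegInBlock D b (b z i) y : ℝ) ≤ r := by
      exact_mod_cast outDegInBlock_le D b _ y
    have h2 : (0 : ℝ) ≤ outDegInBlock D b (b z i) y := Nat.cast_nonneg _
    have h3 := hμ0 (b z i)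
    have h4 := hμr (b z i)
    rw [abs_le]; constructor <;> simp only [g] <;> linarith
  have hfail : ∀ (x : Fin Q → β) (v : Fin t),
      (outDeg (sampleDigraph hr D b x) v : ℝ) < δ * t →
      (γ * t) ^ 2 ≤ (∑ j, g (blockPos hr v) (x (blockIdx r v)) (x j)) ^ 2 := by
    intro x v hv
    set u := b (x (blockIdx r v)) (blockPos hr v) with hu
    have htpos : (0 : ℝ) < t := by exact_mod_cast lt_of_le_of_lt (Nat.zero_le _) v.2
    have hδ : 0 < δ := by
      have : 0 < δ * t := lt_of_le_of_lt (Nat.cast_nonneg _) hv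
      exact pos_of_mul_pos_left this htpos.le
    have h1 : (∑ j, (outDegInBlock D b u (x j) : ℝ)) ≤
        outDeg (sampleDigraph hr D b x) v + 2 * r := by
      exact_mod_cast sum_outDegInBlock_le_outDeg_sampleDigraph hr D b x v
    have h2 : (outDeg D u : ℝ) ≤ ∑ y, (outDegInBlock D b u y : ℝ) + r := by
      exact_mod_cast outDeg_le_sum_outDegInBlock D b hb hcard u
    have h3 : (δ + 3 * γ) * (r * N) - r ≤ μ u * N := by
      have h4 : μ u * N = ∑ y, (outDegInBlock D b u y : ℝ) := div_mul_cancel₀ _ hNpos.ne'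
      have h5 := mul_le_mul_of_nonneg_left hcardR (show 0 ≤ δ + 3 * γ by positivity)
      have h6 := hD u
      rw [h4]; linarith
    -- Vertices outside all blocks cost at most `r` in the total degree, hence at most `Q * r / N ≤
    -- 1` in the mean.
    have h7 : (δ + 3 * γ) * t - 1 ≤ Q * μ u := by
      have h8 : (t : ℝ) ≤ Q * r := by
        have := (Nat.lt_mul_div_succ t hr).le
        rw [mul_comm] at this
        exact_mod_cast this
      have h9 : ((δ + 3 * γ) * (Q * r) - 1) * N ≤ Q * μ u * N := by
        have := mul_le_mul_of_nonneg_left h3 (Nat.cast_nonneg (α := ℝ) Q)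
        nlinarith
      have h10 := le_of_mul_le_mul_right h9 hNpos
      have h11 := mul_le_mul_of_nonneg_left h8 (show 0 ≤ δ + 3 * γ by positivity)
      linarith
    have h12 : ∑ j, g (blockPos hr v) (x (blockIdx r v)) (x j) =
        ∑ j, (outDegInBlock D b u (x j) : ℝ) - Q * μ u := by
      simp [g, Finset.sum_sub_distrib, hu]
    rw [h12]
    have hγt : 0 ≤ γ * t := by positivity
    -- Of the surplus `3 * γ * t`, the errors `2 * r` and `1` use at most `2 * γ * t`.
    nlinarith
  calc (γ * t) ^ 2 * ∑ x : Fin Q → β, ((lowOutDeg (sampleDigraph hr D b x :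
        Digraph (Fin t)) (δ * t)).card : ℝ)
      = ∑ x : Fin Q → β, ∑ v : Fin t,
          if (outDeg (sampleDigraph hr D b x) v : ℝ) < δ * t then (γ * t) ^ 2 else 0 := by
        rw [Finset.mul_sum]
        refine Finset.sum_congr rfl fun x _ => ?_
        rw [lowOutDeg, ← Finset.sum_filter, Finset.sum_const, nsmul_eq_mul, mul_comm]
    _ ≤ ∑ x : Fin Q → β, ∑ v : Fin t,
          (∑ j, g (blockPos hr v) (x (blockIdx r v)) (x j)) ^ 2 := by
        refine Finset.sum_le_sum fun x _ => Finset.sum_le_sum fun v _ => ?_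
        split_ifs with hv
        · exact hfail x v hv
        · positivity
    _ = ∑ v : Fin t, ∑ x : Fin Q → β,
          (∑ j, g (blockPos hr v) (x (blockIdx r v)) (x j)) ^ 2 := Finset.sum_comm
    _ ≤ ∑ _v : Fin t, ((Q : ℕ) * (r : ℝ) ^ 2 * N ^ Q) := by
        refine Finset.sum_le_sum fun v _ => ?_
        have := sum_sq_sum_le (g (blockPos hr v)) r (hg0 _) (hgr _) (blockIdx r v)
        rwa [Fintype.card_fin] at this
    _ = _ := by rw [Finset.sum_const, Finset.card_univ, Fintype.card_fin, nsmul_eq_mul]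

end SampledDigraph

/-! ### Many samples with a surplus of uncovered blocks -/

section DenseSamples

variable {V β : Type*} {r t : ℕ}

open Classical in
/-- The indices at which the sequence `x` takes values in `U`. -/
noncomputable def indicesIn {ι : Type*} [Fintype ι] (U : Finset β) (x : ι → β) : Finset ι :=
  Finset.univ.filter fun j => x j ∈ U

open Classical in
-- By the two moment bounds, the number of uncovered blocks exceeds the number of low vertices by at
-- least `3` on average. The excess is at most `1` on a bad sample and at most `Q` on a good one.
theorem card_filter_good_samples [Fintype V] [Fintype β] (hr : 2 ≤ r) (D : Digraph V)
    (b : β → Fin r → V) (hb : Function.Injective fun a : β × Fin r => b a.1 a.2)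
    (hcard' : r * Fintype.card β ≤ Fintype.card V)
    (hcard : Fintype.card V < r * Fintype.card β + r) {δ γ η : ℝ} (hγ : 0 < γ)
    (hD : ∀ u, (δ + 3 * γ) * Fintype.card V ≤ outDeg D u) (ht2 : 2 ≤ t)
    (ht : 2 * r + 1 ≤ 2 * (γ * t)) (hβ : (t / r + 1) * r ≤ Fintype.card β)
    (U : Finset β) (hU : η * Fintype.card β ≤ U.card)
    (hη : 3 + r ^ 2 / γ ^ 2 ≤ (t / r + 1 : ℕ) * η) :
    (Fintype.card β : ℝ) ^ (t / r + 1) ≤ (t / r + 1 : ℕ) *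
      ((Finset.univ.filter fun x : Fin (t / r + 1) → β =>
        (lowOutDeg (sampleDigraph (by omega) D b x : Digraph (Fin t)) (δ * t)).card + 2 ≤
          (indicesIn U x).card).card : ℝ) := by
  have hr0 : 0 < r := by omega
  have hlow := sum_card_lowOutDeg_le (t := t) hr0 D b hb hcard' hcard hγ hD ht hβ
  have hQt : t / r + 1 ≤ t := by
    have : t / r ≤ t / 2 := Nat.div_le_div_left hr (by norm_num)
    omega
  set Q := t / r + 1 with hQ
  have hNpos : (0 : ℝ) < Fintype.card β := by
    have : 0 < Fintype.card β := lt_of_lt_of_le (Nat.mul_pos (Nat.succ_pos _) hr0) hβ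
    exact_mod_cast this
  have hin := sum_card_filter_mem (ι := Fin Q) U
  rw [Fintype.card_fin, ← Finset.sum_mul] at hin
  set N : ℝ := (Fintype.card β : ℝ) with hN
  have hNQ : 0 < N ^ Q := by positivity
  have htpos : (0 : ℝ) < t := by exact_mod_cast (by omega : 0 < t)
  have hQpos : (0 : ℝ) < Q := by exact_mod_cast Nat.succ_pos _
  have hlow' : ∑ x : Fin Q → β, ((lowOutDeg (sampleDigraph hr0 D b x : Digraph (Fin t))
      (δ * t)).card : ℝ) ≤ r ^ 2 / γ ^ 2 * N ^ Q := by
    have h1 : (t : ℝ) * (Q * r ^ 2 * N ^ Q) ≤ (γ * t) ^ 2 * (r ^ 2 / γ ^ 2 * N ^ Q) := by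
      have h2 : (γ * t) ^ 2 * (r ^ 2 / γ ^ 2 * N ^ Q) = t * (t * r ^ 2 * N ^ Q) := by
        field_simp
      rw [h2]
      have h3 : (Q : ℝ) ≤ t := by exact_mod_cast hQt
      gcongr
    exact le_of_mul_le_mul_left (hlow.trans h1) (by positivity)
  have hin' : Q * η * N ^ Q ≤ ∑ x : Fin Q → β, ((indicesIn U x).card : ℝ) := by
    refine le_of_mul_le_mul_right ?_ hNpos
    have h1 : (∑ x : Fin Q → β, ((indicesIn U x).card : ℝ)) * N = Q * U.card * N ^ Q := by
      rw [← hin]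
      congr! 4
    rw [h1]
    calc Q * η * N ^ Q * N = Q * (η * N) * N ^ Q := by ring
      _ ≤ _ := by gcongr
  set E := Finset.univ.filter fun x : Fin Q → β =>
    (lowOutDeg (sampleDigraph hr0 D b x : Digraph (Fin t)) (δ * t)).card + 2 ≤
      (indicesIn U x).card with hE
  have hupper : ∑ x : Fin Q → β, (((indicesIn U x).card : ℝ) -
      (lowOutDeg (sampleDigraph hr0 D b x : Digraph (Fin t)) (δ * t)).card) ≤
      Q * E.card + N ^ Q := by
    calc _ ≤ ∑ x : Fin Q → β, ((if x ∈ E then (Q : ℝ) else 0) + 1) := by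
          refine Finset.sum_le_sum fun x _ => ?_
          split_ifs with hx
          · have h1 : ((indicesIn U x).card : ℝ) ≤ Q := by
              have := Finset.card_le_univ (indicesIn U x)
              rw [Fintype.card_fin] at this
              exact_mod_cast this
            have h2 : (0 : ℝ) ≤ (lowOutDeg (sampleDigraph hr0 D b x : Digraph (Fin t))
              (δ * t)).card := Nat.cast_nonneg _
            linarith
          · have h1 : (indicesIn U x).card ≤
                (lowOutDeg (sampleDigraph hr0 D b x : Digraph (Fin t)) (δ * t)).card + 1 := by
              by_contra! hcon
              exact hx (Finset.mem_filter.2 ⟨Finset.mem_univ _, by omega⟩)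
            have h2 : ((indicesIn U x).card : ℝ) ≤
                (lowOutDeg (sampleDigraph hr0 D b x : Digraph (Fin t)) (δ * t)).card + 1 := by
              exact_mod_cast h1
            linarith
      _ = _ := by
          rw [Finset.sum_add_distrib]
          simp [hN, mul_comm]
  rw [Finset.sum_sub_distrib] at hupper
  nlinarith [mul_le_mul_of_nonneg_right hη hNQ.le]

end DenseSamples

/-! ### From dense samples to a larger tiling -/

/-- The sides of a box may overlap; Hall's theorem selects disjoint parts from them. -/
theorem exists_injective_selection {ι κ β : Type*} [Fintype ι] [Fintype κ] (A : ι → Finset β)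
    (hA : ∀ j, Fintype.card ι * Fintype.card κ ≤ (A j).card) :
    ∃ f : ι × κ → β, Function.Injective f ∧ ∀ a, f a ∈ A a.1 := by
  classical
  refine (Finset.all_card_le_biUnion_card_iff_exists_injective fun a : ι × κ => A a.1).1
    fun s => ?_
  rcases s.eq_empty_or_nonempty with rfl | ⟨a, ha⟩
  · simp
  · calc s.card ≤ Fintype.card (ι × κ) := Finset.card_le_univ _
      _ ≤ (A a.1).card := by rw [Fintype.card_prod]; exact hA _
      _ ≤ _ := Finset.card_le_card (Finset.subset_biUnion_of_mem (fun a : ι × κ => A a.1) ha)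

theorem minOutDeg_ge {W : Type*} [Nonempty W] {R : Digraph W} {d : ℝ}
    (h : ∀ v, d ≤ outDeg R v) : d ≤ minOutDeg R := by
  obtain ⟨v, hv⟩ := ciInf_mem fun v => outDeg R v
  rw [minOutDeg, ← hv]
  exact h v

/-- Adding all arcs out of the vertices of `F`. -/
def completeOutOf {W : Type*} (R : Digraph W) (F : Finset W) : Digraph W where
  Adj v w := v ≠ w ∧ (v ∈ F ∨ R.Adj v w)

theorem le_minOutDeg_completeOutOf {W : Type*} [Fintype W] [Nonempty W] {R : Digraph W}
    (hR : DigraphLoopless R) {d : ℝ} (hd : d ≤ Fintype.card W - 1) :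
    d ≤ minOutDeg (completeOutOf R (lowOutDeg R d)) := by
  classical
  refine minOutDeg_ge fun v => ?_
  by_cases hv : v ∈ lowOutDeg R d
  · have h1 : {w | (completeOutOf R (lowOutDeg R d)).Adj v w} =
        ((Finset.univ.erase v : Finset W) : Set W) := by
      ext w; simp [completeOutOf, hv, eq_comm]
    rw [outDeg, h1, Set.ncard_coe_finset, Finset.card_erase_of_mem (Finset.mem_univ _),
      Finset.card_univ, Nat.cast_sub Fintype.card_pos]
    simpa using hd
  · have h1 : d ≤ outDeg R v := by
      by_contra! hcon
      exact hv (Finset.mem_filter.2 ⟨Finset.mem_univ _, hcon⟩)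
    refine h1.trans ?_
    have h2 : outDeg R v ≤ outDeg (completeOutOf R (lowOutDeg R d)) v := by
      refine Set.ncard_le_ncard ?_ (Set.toFinite _)
      intro w hw
      exact ⟨fun h => hR v (by rw [← h] at hw; exact hw), Or.inr hw⟩
    exact_mod_cast h2

/-- The size of the parts of the blow-ups in which a tiling is improved. -/
def blowUpSize (r t : ℕ) : ℕ :=
  (r ^ 4 + 1) * (t / r + 1) + Fintype.card (Finset (Fin t) × Finset (Fin t × Fin t)) + 1
    + r ^ 4 + 1

/-- A lower bound for the density of the samples of a suitable fixed type. -/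
noncomputable def typeDensity (r t : ℕ) : ℝ :=
  1 / ((t / r + 1 : ℕ) * (Nat.card (Digraph (Fin t) × Finset (Fin (t / r + 1))) : ℝ))

theorem typeDensity_pos (r t : ℕ) : 0 < typeDensity r t := by
  have : 0 < Nat.card (Digraph (Fin t) × Finset (Fin (t / r + 1))) := by
    have : Nonempty (Digraph (Fin t)) := ⟨⊥⟩
    exact Nat.card_pos
  have h : (0 : ℝ) < Nat.card (Digraph (Fin t) × Finset (Fin (t / r + 1))) := by
    exact_mod_cast this
  unfold typeDensity
  positivity

theorem exists_larger_tiling_of_uncovered {V β C : Type*} [Fintype V] [Fintype β]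
    {G : SimpleGraph V} {c : G.EdgeLabeling C} {D : Digraph V} {r t : ℕ} (hr : 2 ≤ r)
    (hD : IsOutRainbow c D) {T₀ : Finset (Finset V)} (hT₀ : IsRainbowCliqueTiling c r T₀)
    (b : β → Fin r → V) (hb : Function.Injective fun a : β × Fin r => b a.1 a.2)
    (hcard' : r * Fintype.card β ≤ Fintype.card V)
    (hcard : Fintype.card V < r * Fintype.card β + r) {δ γ η : ℝ} (hγ : 0 < γ)
    (hDdeg : ∀ u, (δ + 3 * γ) * Fintype.card V ≤ outDeg D u) (ht2 : 2 ≤ t)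
    (ht : 2 * r + 1 ≤ 2 * (γ * t)) (hβ : (t / r + 1) * r ≤ Fintype.card β)
    (U : Finset β) (hUT₀ : ∀ y ∈ U, ∀ i, ∀ S ∈ T₀, b y i ∉ S)
    (hUcT₀ : ∀ y ∉ U, ∃ S ∈ T₀, ∀ i, b y i ∈ S) (hU : η * Fintype.card β ≤ U.card)
    (hη : 3 + r ^ 2 / γ ^ 2 ≤ (t / r + 1 : ℕ) * η)
    (hbox : ∀ E : Finset (Fin (t / r + 1) → β),
      typeDensity r t * (Fintype.card β : ℝ) ^ (t / r + 1) ≤ E.card →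
      ∃ A : Fin (t / r + 1) → Finset β, (∀ j, (A j).card = (t / r + 1) * blowUpSize r t) ∧
        ∀ x, (∀ j, x j ∈ A j) → x ∈ E)
    (hfrac : ∀ R : Digraph (Fin t), DigraphLoopless R → δ * t ≤ (minOutDeg R : ℝ) →
      HasPerfectFractionalTiling r R) :
    ∃ T : Finset (Finset V), IsRainbowCliqueTiling c r T ∧ T₀.card < T.card := by
  classical
  have hr0 : 0 < r := by omega
  have hdense := card_filter_good_samples hr D b hb hcard' hcard hγ hDdeg ht2 ht hβ U hU hη
  set Q := t / r + 1 with hQ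
  have hQpos : (0 : ℝ) < Q := by exact_mod_cast Nat.succ_pos _
  set E := Finset.univ.filter fun x : Fin Q → β =>
    (lowOutDeg (sampleDigraph hr0 D b x : Digraph (Fin t)) (δ * t)).card + 2 ≤
      (indicesIn U x).card with hE
  -- The type of a sample. The number of types depends only on `r` and `t`, so some type is dense.
  let τ : (Fin Q → β) → Digraph (Fin t) × Finset (Fin Q) := fun x =>
    (sampleDigraph hr0 D b x, indicesIn U x)
  have : Fintype (Digraph (Fin t) × Finset (Fin Q)) := Fintype.ofFinite _
  have : Nonempty (Digraph (Fin t)) := ⟨⊥⟩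
  obtain ⟨⟨R, P⟩, -, hRP⟩ := Finset.exists_le_card_fiber_of_nsmul_le_card_of_maps_to
    (M := ℝ) (b := typeDensity r t * (Fintype.card β : ℝ) ^ Q) (s := E) (f := τ)
    (t := Finset.univ) (fun _ _ => Finset.mem_univ _) Finset.univ_nonempty (by
      have hk : (0 : ℝ) < Nat.card (Digraph (Fin t) × Finset (Fin Q)) := by
        exact_mod_cast Nat.card_pos
      rw [Finset.card_univ, ← Nat.card_eq_fintype_card, nsmul_eq_mul, typeDensity]
      rw [show (Nat.card (Digraph (Fin t) × Finset (Fin Q)) : ℝ) *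
        (1 / ((Q : ℕ) * (Nat.card (Digraph (Fin t) × Finset (Fin Q)) : ℝ)) *
          (Fintype.card β : ℝ) ^ Q) = (Fintype.card β : ℝ) ^ Q / Q by field_simp]
      rw [div_le_iff₀ hQpos]
      linarith)
  obtain ⟨A, hA, hAE⟩ := hbox _ hRP
  obtain ⟨f, hf, hfA⟩ := exists_injective_selection (κ := Fin (blowUpSize r t)) A
    fun j => by simp [hA]
  have hxE : ∀ x : Fin Q → β, (∀ j, ∃ k, x j = f (j, k)) → x ∈ E ∧
      sampleDigraph hr0 D b x = R ∧ indicesIn U x = P := by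
    intro x hx
    have h1 := hAE x fun j => by
      obtain ⟨k, hk⟩ := hx j
      rw [hk]; exact hfA (j, k)
    obtain ⟨h2, h3⟩ := Finset.mem_filter.1 h1
    exact ⟨h2, congrArg Prod.fst h3, congrArg Prod.snd h3⟩
  have hsizepos : 0 < blowUpSize r t := Nat.succ_pos _
  have hk0 : Nonempty (Fin (blowUpSize r t)) := ⟨⟨0, hsizepos⟩⟩
  obtain ⟨k₀⟩ := hk0
  obtain ⟨hx₀E, hx₀R, hx₀P⟩ := hxE (fun j => f (j, k₀)) fun j => ⟨k₀, rfl⟩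
  have hfP : ∀ j k, f (j, k) ∈ U ↔ j ∈ P := by
    intro j k
    obtain ⟨-, -, h⟩ := hxE (fun j => f (j, k)) fun j => ⟨k, rfl⟩
    rw [← h]; simp [indicesIn]
  have hgood : (lowOutDeg R (δ * t)).card + 2 ≤ P.card := by
    have := (Finset.mem_filter.1 hx₀E).2
    rwa [hx₀R, hx₀P] at this
  have hRloop : DigraphLoopless R := by
    intro v hv
    rw [← hx₀R] at hv
    exact hv.1 rfl
  let φ : Fin t → Fin (blowUpSize r t) → V := fun v k => b (f (blockIdx r v, k)) (blockPos hr0 v)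
  have hφ : Function.Injective fun a : Fin t × Fin (blowUpSize r t) => φ a.1 a.2 := by
    rintro ⟨v, k⟩ ⟨w, l⟩ h
    obtain ⟨h1, h2⟩ := Prod.ext_iff.1 (hb (a₁ := (f (blockIdx r v, k), blockPos hr0 v))
      (a₂ := (f (blockIdx r w, l), blockPos hr0 w)) h)
    obtain ⟨h3, h4⟩ := Prod.ext_iff.1 (hf h1)
    exact Prod.ext (eq_of_blockIdx_eq_of_blockPos_eq hr0 h3 h2) h4
  have hRD : ∀ v w k l, R.Adj v w → D.Adj (φ v k) (φ w l) := by
    intro v w k l hvw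
    have hne : blockIdx r v ≠ blockIdx r w := by
      rw [← hx₀R] at hvw
      exact hvw.1
    -- A mixed sample, with copy `k` at the block of `v` and copy `l` elsewhere, still lies in the
    -- box and so induces the same `R`.
    obtain ⟨-, hxR, -⟩ := hxE (fun j => if j = blockIdx r v then f (j, k) else f (j, l))
      fun j => by
        by_cases hj : j = blockIdx r v
        · exact ⟨k, if_pos hj⟩
        · exact ⟨l, if_neg hj⟩
    rw [← hxR] at hvw
    have := hvw.2
    simpa [hne.symm, φ] using this
  choose! tile htile htilemem using hUcT₀
  let T₁ : Finset (Finset V) :=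
    (Pᶜ ×ˢ (Finset.univ : Finset (Fin (blowUpSize r t)))).image fun a => tile (f a)
  have hT₁ : T₁ ⊆ T₀ := by
    intro S hS
    obtain ⟨⟨j, k⟩, ha, rfl⟩ := Finset.mem_image.1 hS
    have hj := Finset.mem_compl.1 (Finset.mem_product.1 ha).1
    exact htile _ fun h => hj ((hfP j k).1 h)
  have hT₁φ : ∀ v k, ∀ S ∈ T₀, φ v k ∈ S → S ∈ T₁ := by
    intro v k S hS hvS
    have hnU : f (blockIdx r v, k) ∉ U := fun h => hUT₀ _ h _ S hS hvS
    have hST : S = tile (f (blockIdx r v, k)) := by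
      by_contra hne
      exact Finset.disjoint_left.1 (hT₀.2 S hS _ (htile _ hnU) hne) hvS
        (htilemem _ hnU (blockPos hr0 v))
    refine Finset.mem_image.2 ⟨(blockIdx r v, k), ?_, hST.symm⟩
    refine Finset.mem_product.2 ⟨Finset.mem_compl.2 fun h => hnU ((hfP _ k).2 h),
      Finset.mem_univ _⟩
  have hT₁card : T₁.card ≤ (Q - P.card) * blowUpSize r t := by
    refine Finset.card_image_le.trans (le_of_eq ?_)
    rw [Finset.card_product, Finset.card_compl, Finset.card_univ, Fintype.card_fin,
      Fintype.card_fin]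
  have hPQ : P.card ≤ Q := by simpa using Finset.card_le_univ P
  have : Nonempty (Fin t) := ⟨⟨0, by omega⟩⟩
  have hδ : δ * t ≤ Fintype.card (Fin t) - 1 := by
    have hVpos : 0 < Fintype.card V := by
      refine lt_of_lt_of_le (Nat.mul_pos hr0 ?_) hcard'
      exact lt_of_lt_of_le (Nat.mul_pos (Nat.succ_pos _) hr0) hβ
    obtain ⟨u⟩ := Fintype.card_pos_iff.1 hVpos
    have h1 : outDeg D u ≤ Fintype.card V := by
      rw [outDeg, ← Nat.card_eq_fintype_card]
      exact Set.ncard_le_card _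
    have h2 : (δ + 3 * γ) * Fintype.card V ≤ 1 * Fintype.card V := by
      rw [one_mul]
      exact (hDdeg u).trans (by exact_mod_cast h1)
    have h3 := le_of_mul_le_mul_right h2 (by exact_mod_cast hVpos)
    have htpos : (0 : ℝ) < t := by exact_mod_cast (by omega : 0 < t)
    have h4 := mul_le_mul_of_nonneg_right h3 htpos.le
    rw [Fintype.card_fin]
    have h5 : (0 : ℝ) ≤ r := Nat.cast_nonneg _
    nlinarith
  have hR'frac := hfrac (completeOutOf R (lowOutDeg R (δ * t))) (fun v hv => hv.1 rfl)
    (le_minOutDeg_completeOutOf hRloop hδ)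
  refine exists_larger_tiling (R' := completeOutOf R (lowOutDeg R (δ * t)))
    (F := lowOutDeg R (δ * t)) (T₁ := T₁)
    (B := (r ^ 4 + 1) * Q + Fintype.card (Finset (Fin t) × Finset (Fin t × Fin t)) + 1)
    hr0 hD hRloop hφ hRD ?_ hR'frac hT₀ hT₁ hT₁φ ?_ ?_
  · intro v w hv hvw
    exact hvw.2.resolve_left hv
  · rw [Fintype.card_fin, blowUpSize]
    exact Nat.lt_succ_self _
  · rw [Fintype.card_fin (n := t)]
    set k := Fintype.card (Finset (Fin t) × Finset (Fin t × Fin t)) with hk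
    set F := (lowOutDeg R (δ * t)).card with hF
    have hsize : blowUpSize r t = ((r ^ 4 + 1) * Q + k + 1) + (r ^ 4 + 1) := by
      rw [blowUpSize]; ring
    set B := (r ^ 4 + 1) * Q + k + 1 with hBdef
    -- Since `Q = t / r + 1`, one unit of the surplus `2` pays for the truncated last block. The
    -- other yields a gain of `B`, which was chosen to exceed both the rounding loss `k` and the `r
    -- ^ 4 + 1` spare copies of each covered block.
    have h1 : T₁.card + B * F + k < B * (t / r) := by
      obtain ⟨d, hd⟩ := Nat.exists_eq_add_of_le hPQ
      have hQd : Q - P.card = d := by omega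
      rw [hQd, hsize] at hT₁card
      have h2 : d + F + 1 ≤ t / r := by omega
      have h3 : B * (d + F + 1) ≤ B * (t / r) := Nat.mul_le_mul_left _ h2
      have h4 : d * (r ^ 4 + 1) ≤ (r ^ 4 + 1) * Q := by
        rw [mul_comm]; exact Nat.mul_le_mul_left _ (by omega)
      nlinarith
    calc r * (T₁.card + B * F + k) < r * (B * (t / r)) := Nat.mul_lt_mul_of_pos_left h1 hr0
      _ = B * (r * (t / r)) := by ring
      _ ≤ B * t := Nat.mul_le_mul_left _ (Nat.mul_div_le t r)

/-! ### The almost perfect tiling -/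

theorem exists_card_maximal_tiling {V C : Type*} [Fintype V] {G : SimpleGraph V}
    (c : G.EdgeLabeling C) (r : ℕ) :
    ∃ T : Finset (Finset V), IsRainbowCliqueTiling c r T ∧
      ∀ T', IsRainbowCliqueTiling c r T' → T'.card ≤ T.card := by
  classical
  obtain ⟨T, hT, hmax⟩ := Finset.exists_max_image
    (Finset.univ.filter fun T : Finset (Finset V) => IsRainbowCliqueTiling c r T) Finset.card
    ⟨∅, Finset.mem_filter.2 ⟨Finset.mem_univ _, by simp, by simp⟩⟩
  exact ⟨T, (Finset.mem_filter.1 hT).2, fun T' hT' =>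
    hmax T' (Finset.mem_filter.2 ⟨Finset.mem_univ _, hT'⟩)⟩

theorem lemma5p1 (r : ℕ) (hr : 3 ≤ r) (γ : ℝ) (hγ : 0 < γ) :
    ∃ ε₀ : ℝ, 0 < ε₀ ∧ ∀ ε : ℝ, 0 < ε → ε ≤ ε₀ →
    ∃ t₀ : ℕ, ∀ t : ℕ, t₀ ≤ t →
    ∃ n₀ : ℕ, ∀ n : ℕ, n₀ ≤ n →
    ∀ δ : ℝ,
      (∀ R : Digraph (Fin t), DigraphLoopless R → δ * t ≤ (minOutDeg R : ℝ) →
        HasPerfectFractionalTiling r R) →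
    ∀ (V : Type*) [Fintype V] (C : Type*) (G : SimpleGraph V) (c : G.EdgeLabeling C),
      Fintype.card V = n →
      (δ + 3 * γ) * n ≤ (minColourDeg c : ℝ) →
      ∃ T : Finset (Finset V), IsRainbowCliqueTiling c r T ∧
        (numUncovered T : ℝ) ≤ 3 * Real.sqrt ε * n := by
  -- Any positive `ε₀` would do: `ε` enters only through the uncovered proportion `η`.
  refine ⟨1, one_pos, fun ε hε _ => ?_⟩
  set η := 3 * Real.sqrt ε with hηdef
  have hη : 0 < η := by positivity
  have hr0 : 0 < r := by omega
  have hrR : (0 : ℝ) < r := by exact_mod_cast hr0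
  obtain ⟨t₁, ht₁⟩ := exists_nat_ge ((2 * r + 1) / (2 * γ))
  obtain ⟨t₂, ht₂⟩ := exists_nat_ge (r * ((3 + r ^ 2 / γ ^ 2) / (η / 2)))
  refine ⟨max 2 (max t₁ t₂), fun t ht => ?_⟩
  have ht2 : 2 ≤ t := (le_max_left _ _).trans ht
  have htt₁ : (t₁ : ℝ) ≤ t := by
    exact_mod_cast (le_max_left _ _).trans ((le_max_right _ _).trans ht)
  have htt₂ : (t₂ : ℝ) ≤ t := by
    exact_mod_cast (le_max_right _ _).trans ((le_max_right _ _).trans ht)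
  have htγ : 2 * r + 1 ≤ 2 * (γ * t) := by
    have := ht₁.trans htt₁
    rw [div_le_iff₀ (by positivity)] at this
    linarith
  have hQη : 3 + r ^ 2 / γ ^ 2 ≤ (t / r + 1 : ℕ) * (η / 2) := by
    rw [← div_le_iff₀ (by positivity)]
    have h1 : (t : ℝ) ≤ r * (t / r + 1 : ℕ) := by
      exact_mod_cast (Nat.lt_mul_div_succ t hr0).le
    exact le_of_mul_le_mul_left ((ht₂.trans htt₂).trans h1) hrR
  obtain ⟨N₀, hN₀⟩ := exists_box_subset (t / r + 1) ((t / r + 1) * blowUpSize r t)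
    (typeDensity r t) (typeDensity_pos r t)
  obtain ⟨N₁, hN₁⟩ := exists_nat_ge (2 / η)
  set N := max N₀ (max N₁ ((t / r + 1) * r)) with hN
  refine ⟨r * N + r, fun n hn δ hfrac V _ C G c hV hdeg => ?_⟩
  obtain ⟨D, hD, hDdeg⟩ := exists_isOutRainbow c
  obtain ⟨T, hT, hmax⟩ := exists_card_maximal_tiling c r
  refine ⟨T, hT, ?_⟩
  by_contra! hunc
  obtain ⟨β, _, b, U, hb, hcard', hcard, hUcard, hUT, hUcT⟩ :=
    exists_blocks hr0 T (fun S hS => (hT.1 S hS).1.card_eq) hT.2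
  have hNβ : N ≤ Fintype.card β := by
    have h1 : r * N < r * Fintype.card β := by omega
    exact (Nat.lt_of_mul_lt_mul_left h1).le
  -- Grouping the uncovered vertices may lose one incomplete block; `2 / η ≤ |β|` absorbs it at the
  -- price of halving `η`.
  have hU : η / 2 * Fintype.card β ≤ U.card := by
    have h1 : (numUncovered T : ℝ) ≤ r * (U.card + 1) := by
      rw [hUcard]
      exact_mod_cast (Nat.lt_mul_div_succ _ hr0).le
    have h2 : (r : ℝ) * Fintype.card β ≤ n := by rw [← hV]; exact_mod_cast hcard'
    have h3 : r * (η * Fintype.card β) ≤ r * (U.card + 1) := by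
      have := mul_le_mul_of_nonneg_left h2 hη.le
      linarith
    have h4 := le_of_mul_le_mul_left h3 hrR
    have h5 : 2 / η ≤ Fintype.card β := hN₁.trans (by
      exact_mod_cast ((le_max_left _ _).trans (le_max_right _ _)).trans hNβ)
    rw [div_le_iff₀ hη] at h5
    linarith
  obtain ⟨T', hT', hlt⟩ := exists_larger_tiling_of_uncovered (by omega : 2 ≤ r) hD hT b hb hcard'
    hcard hγ (fun u => by
      rw [hV]
      refine hdeg.trans ?_
      have h1 : minColourDeg c ≤ colourDeg c u := ciInf_le (OrderBot.bddBelow _) u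
      exact_mod_cast h1.trans (hDdeg u)) ht2 htγ
    (((le_max_right _ _).trans (le_max_right _ _)).trans hNβ) U hUT hUcT hU hQη
    (hN₀ β ((le_max_left _ _).trans hNβ)) hfrac
  exact absurd (hmax T' hT') (not_le.2 hlt)
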